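/- Work in $\mathbb{C}^2$ with the Euclidean norm, and consider germs of sets at the origin. A germ of complex analytic plane curve at $0$ is the germ at $0$ of the zero set of a holomorphic function $f$ defined near $0$ with $f(0)=0$ and $f\not\equiv 0$. An analytic germ (the germ at $0$ of the common zero set of finitely many holomorphic functions) is irreducible if it is nonempty and is not the union of two analytic germs both different from it; the irreducible components of a curve germ are the maximal irreducible analytic germs contained in it. For $\alpha>0$, a bi-$\alpha$-Hölder homeomorphism $h:(C,0)\to(\tilde C,0)$ is a germ of homeomorphism such that $h$ and $h^{-1}$ are $\alpha$-Hölder, i.e. $\|h(p)-h(q)\|\le K\|p-q\|^{\alpha}$ for some constant $K>0$ and all $p,q$ in a representative of $(C,0)$, and similarly for $h^{-1}$. For germs at $0$ of closed sets $\Gamma_1,\Gamma_2$ with $\Gamma_1\cap\Gamma_2=\{0\}$ (represented by their parts in a sufficiently small closed ball around $0$) put, for small $r>0$, $$f_{\Gamma_1,\Gamma_2}(r)=\inf\{\|\gamma_1-\gamma_2\| : \gamma_i\in\Gamma_i,\ \|\gamma_i\|\ge r,\ i=1,2\},\qquad \mathrm{Cont}(\Gamma_1,\Gamma_2)=\lim_{r\to0^+}\frac{\ln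 f_{\Gamma_1,\Gamma_2}(r)}{\ln r}.$$ **Proposition.** Let $C$ and $\tilde C$ be germs of complex analytic plane curves at $0\in\mathbb{C}^2$, let $\alpha>0$, and let $h:(C,0)\to(\tilde C,0)$ be a bi-$\alpha$-Hölder homeomorphism. If $C_1,\dots,C_r$ are the (pairwise distinct) irreducible components of $C$, then $h(C_1),\dots,h(C_r)$ are the (pairwise distinct) irreducible components of $\tilde C$, and for all $i\ne j$ the contacts $\mathrm{Cont}(C_i,C_j)$ and $\mathrm{Cont}(h(C_i),h(C_j))$ exist as real numbers and satisfy $$\alpha^2\le\frac{\mathrm{Cont}(C_i,C_j)}{\mathrm{Cont}(h(C_i),h(C_j))}\le\frac1{\alpha^2}.$$ -/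

import Mathlib

open Filter Topology

/-- The complex plane `ℂ²` with its Euclidean (Hermitian) norm. -/
abbrev C2 : Type := EuclideanSpace ℂ (Fin 2)

/-! Germs at the origin of subsets of `ℂ²` are represented by sets `X : Set C2`; two sets represent
the same germ when `X =ᶠ[𝓝 0] Y`, and `X ≤ᶠ[𝓝 0] Y` is the inclusion of germs. -/

/-- `X` represents a complex analytic set germ at `0`: near `0` it is the common zero set of
finitely many holomorphic functions. (The empty germ and the full germ are allowed.) -/
def IsAnalyticGerm (X : Set C2) : Prop :=
  ∃ (k : ℕ) (F : Fin k → C2 → ℂ), (∀ i, AnalyticAt ℂ (F i) 0) ∧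
    X =ᶠ[𝓝 (0 : C2)] {z : C2 | ∀ i, F i z = 0}

/-- `X` represents the germ at `0` of a complex analytic plane curve: near `0` it is the zero set of
a holomorphic function that vanishes at `0` and does not vanish identically near `0`. -/
def IsPlaneCurveGerm (X : Set C2) : Prop :=
  ∃ f : C2 → ℂ, AnalyticAt ℂ f 0 ∧ f 0 = 0 ∧ (¬ ∀ᶠ z in 𝓝 (0 : C2), f z = 0) ∧
    X =ᶠ[𝓝 (0 : C2)] {z : C2 | f z = 0}

/-- `X` represents an irreducible analytic germ at `0`: it is nonempty and is not the union of two
analytic germs both different from it. -/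
def IsIrreducibleGerm (X : Set C2) : Prop :=
  IsAnalyticGerm X ∧ (¬ X =ᶠ[𝓝 (0 : C2)] (∅ : Set C2)) ∧
    ∀ X₁ X₂ : Set C2, IsAnalyticGerm X₁ → IsAnalyticGerm X₂ →
      X =ᶠ[𝓝 (0 : C2)] (X₁ ∪ X₂ : Set C2) → X =ᶠ[𝓝 (0 : C2)] X₁ ∨ X =ᶠ[𝓝 (0 : C2)] X₂

/-- `Z` represents an irreducible component of the germ of `X`: a maximal irreducible analytic germ
contained in it. -/
def IsIrreducibleComponentGerm (Z X : Set C2) : Prop :=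
  IsIrreducibleGerm Z ∧ Z ≤ᶠ[𝓝 (0 : C2)] X ∧
    ∀ W : Set C2, IsIrreducibleGerm W → Z ≤ᶠ[𝓝 (0 : C2)] W → W ≤ᶠ[𝓝 (0 : C2)] X →
      W =ᶠ[𝓝 (0 : C2)] Z

/-- `C 0, …, C (r - 1)` are the irreducible components of the germ of `X`: each is one, there are no
others, and they are listed without repetition. -/
def AreIrreducibleComponents {r : ℕ} (C : Fin r → Set C2) (X : Set C2) : Prop :=
  (∀ i, IsIrreducibleComponentGerm (C i) X) ∧
    (∀ Z : Set C2, IsIrreducibleComponentGerm Z X → ∃ i, Z =ᶠ[𝓝 (0 : C2)] C i) ∧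
    ∀ i j, C i =ᶠ[𝓝 (0 : C2)] C j → i = j

/-- `h` represents a bi-`α`-Hölder homeomorphism of germs `(X, 0) → (Y, 0)`: it is a bijection from a
representative of `(X, 0)` onto a representative of `(Y, 0)` that fixes `0`, and both it and its
inverse are `α`-Hölder (hence, for `α > 0`, continuous). -/
structure IsBiHolderGermHomeo (α : NNReal) (X Y : Set C2) (h : PartialEquiv C2 C2) : Prop where
  source_eq : h.source =ᶠ[𝓝 (0 : C2)] X
  target_eq : h.target =ᶠ[𝓝 (0 : C2)] Y
  zero_mem : (0 : C2) ∈ h.source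
  map_zero : h 0 = 0
  holder : ∃ K : NNReal, HolderOnWith K α h h.source
  holder_symm : ∃ K : NNReal, HolderOnWith K α h.symm h.target

/-- The image under `h` of the germ of `Z`. -/
def germImage (h : PartialEquiv C2 C2) (Z : Set C2) : Set C2 :=
  h '' (h.source ∩ Z)

/-- `f_{Γ₁,Γ₂}(r) = inf {‖γ₁ - γ₂‖ | γᵢ ∈ Γᵢ, ‖γᵢ‖ ≥ r}`. -/
noncomputable def contactDist (Γ₁ Γ₂ : Set C2) (r : ℝ) : ℝ :=
  sInf {d : ℝ | ∃ γ₁ ∈ Γ₁, ∃ γ₂ ∈ Γ₂, r ≤ ‖γ₁‖ ∧ r ≤ ‖γ₂‖ ∧ d = ‖γ₁ - γ₂‖}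

/-- The germs at `0` of `Γ₁` and `Γ₂` have contact `c`:
`lim_{r → 0⁺} ln f_{Γ₁,Γ₂}(r) / ln r = c`, where `f_{Γ₁,Γ₂}` is computed with the
representatives of the germs in any sufficiently small closed ball around `0`. -/
def HasContact (Γ₁ Γ₂ : Set C2) (c : ℝ) : Prop :=
  ∀ᶠ ε in 𝓝[>] (0 : ℝ),
    Tendsto
      (fun r : ℝ =>
        Real.log (contactDist (Γ₁ ∩ Metric.closedBall 0 ε) (Γ₂ ∩ Metric.closedBall 0 ε) r) /
          Real.log r)
      (𝓝[>] 0) (𝓝 c)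

/-!
The proof describes plane curve germs by Puiseux parametrizations and reads off everything from
them.

*Branches.* In linear coordinates whose `y`-axis is not tangent to the curve
(`exists_coordinates`), the Newton–Puiseux theorem (`exists_puiseux_root`, `exists_puiseux_roots`)
presents a curve germ as a finite union of arcs `t ↦ (t ^ N, φ t)` with `φ` analytic and
`φ t = O(t ^ N)` (`exists_branches`). It is proved by the Newton polygon: after the Tschirnhaus shift the
initial polynomial has a root of multiplicity smaller than the order `d` in `y`, and one recurses
on `d`. Besides the implicit function theorem, the only tool from several complex variables is
division by `y` of an analytic function that vanishes on `y = 0` (`exists_eq_add_snd_mul`), done on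
power series. All branches of one
curve share the same `N`.

*Components.* A branch is the zero set of the norm `∏_{ζ ^ N = 1} (y - φ (ζ t))`, an analytic
function of `x = t ^ N` and `y` (`exists_branch_eq`). An analytic germ contains a branch or meets
it only at the origin, since an analytic function of `t` vanishes identically or has an isolated
zero (`analyticGerm_dichotomy`). Hence branches are irreducible, they are the components of the
curve, and different ones meet only at the origin.

*Transport.* A branch without the origin is the image of a punctured disk, hence connected, and
the other curve without the origin is the disjoint union of its finitely many relatively closed
branches. So the homeomorphism maps a branch into a branch (`exists_germImage_branch_le`);
together with the same statement for the inverse it maps components onto components.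

*Contact.* For two branches `y = φ t` and `y = χ t`, let `m` be the largest order of
`φ t - χ (ζ t)` over the roots of unity `ζ`. Since branches are Lipschitz over the `x`-axis
(`exists_root_near`), the distance of points outside the ball of radius `r` is bounded below by a
multiple of `r ^ (m / N)`, and this size is attained; so the contact is `m / N`, which is at least
`1` (`exists_hasPowerContact_branch`). A bi-`α`-Hölder map changes the radius and the distance by
an exponent `α` each, which gives the factor `α ^ 2` (`contact_mul_sq_le`).
-/

namespace PlaneCurve

attribute [fun_prop] analyticAt_fst analyticAt_snd

/-! ### Division and Taylor expansion in the second variable -/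

/-- The degree `n` part of the quotient by `y` of `F (x, y) - F (x, 0)`, where `P` is the degree
`n + 1` part of `F`: the telescoping sum of `P ((x, y), …, (x, y), (0, 1), (x, 0), …, (x, 0))`. -/
noncomputable def quotientTerm {n : ℕ} (P : (ℂ × ℂ) [×(n + 1)]→L[ℂ] ℂ) :
    (ℂ × ℂ) [×n]→L[ℂ] ℂ :=
  ∑ i : Fin (n + 1),
    (ContinuousMultilinearMap.curryMid i P ((0, 1) : ℂ × ℂ)).compContinuousLinearMap
      fun j => if i.succAbove j < i then ContinuousLinearMap.id ℂ (ℂ × ℂ)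
        else (ContinuousLinearMap.inl ℂ ℂ ℂ).comp (ContinuousLinearMap.fst ℂ ℂ ℂ)

lemma norm_quotientTerm_le {n : ℕ} (P : (ℂ × ℂ) [×(n + 1)]→L[ℂ] ℂ) :
    ‖quotientTerm P‖ ≤ (n + 1) * ‖P‖ := by
  have h1 : ∀ i ∈ (Finset.univ : Finset (Fin (n + 1))),
      ‖(ContinuousMultilinearMap.curryMid i P ((0, 1) : ℂ × ℂ)).compContinuousLinearMap
        fun j => if i.succAbove j < i then ContinuousLinearMap.id ℂ (ℂ × ℂ)
          else (ContinuousLinearMap.inl ℂ ℂ ℂ).comp (ContinuousLinearMap.fst ℂ ℂ ℂ)‖ ≤ ‖P‖ := by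
    intro i _
    refine (ContinuousMultilinearMap.norm_compContinuousLinearMap_le _ _).trans ?_
    have h2 : ‖ContinuousMultilinearMap.curryMid i P ((0, 1) : ℂ × ℂ)‖ ≤ ‖P‖ := by
      refine (ContinuousLinearMap.le_opNorm _ _).trans ?_
      rw [ContinuousMultilinearMap.norm_curryMid]
      simp [Prod.norm_def]
    have h3 : ∏ j : Fin n, ‖(if i.succAbove j < i then ContinuousLinearMap.id ℂ (ℂ × ℂ)
          else (ContinuousLinearMap.inl ℂ ℂ ℂ).comp (ContinuousLinearMap.fst ℂ ℂ ℂ))‖ ≤ 1 := by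
      refine Finset.prod_le_one (fun _ _ => norm_nonneg _) fun j _ => ?_
      split_ifs
      · exact ContinuousLinearMap.norm_id_le
      · refine ContinuousLinearMap.opNorm_le_bound _ zero_le_one fun v => ?_
        simp [Prod.norm_def]
    calc _ ≤ ‖P‖ * 1 := mul_le_mul h2 h3 (Finset.prod_nonneg fun _ _ => norm_nonneg _)
          (norm_nonneg _)
      _ = ‖P‖ := mul_one _
  refine (norm_sum_le_of_le _ h1).trans ?_
  simp

lemma snd_mul_quotientTerm {n : ℕ} (P : (ℂ × ℂ) [×(n + 1)]→L[ℂ] ℂ) (v : ℂ × ℂ) :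
    v.2 * quotientTerm P (fun _ => v) = P (fun _ => v) - P (fun _ => (v.1, 0)) := by
  have h := P.toMultilinearMap.map_sub_map_piecewise (fun _ => v) (fun _ => (v.1, 0)) Finset.univ
  simp only [Finset.piecewise_univ, ContinuousMultilinearMap.coe_coe, Finset.mem_univ,
    forall_true_left] at h
  rw [h, quotientTerm, sum_apply, Finset.mul_sum]
  refine Finset.sum_congr rfl fun i _ => ?_
  rw [ContinuousMultilinearMap.compContinuousLinearMap_apply,
    ContinuousMultilinearMap.curryMid_apply, ← smul_eq_mul]
  have e : v - (v.1, 0) = v.2 • ((0, 1) : ℂ × ℂ) := by ext <;> simp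
  have h2 := P.toMultilinearMap.map_update_smul
    (fun j => if j < i then v else (v.1, 0)) i v.2 ((0, 1) : ℂ × ℂ)
  simp only [ContinuousMultilinearMap.coe_coe] at h2
  convert h2.symm using 2
  · congr 1
    funext j
    refine Fin.succAboveCases i ?_ (fun k => ?_) j
    · simp
    · simp only [Fin.insertNth_apply_succAbove, Function.update_of_ne (Fin.succAbove_ne i k)]
      split_ifs <;> simp
  · funext j
    by_cases hj : j = i
    · subst hj; simp [e]
    · simp [Function.update_of_ne hj, Ne.symm hj]

/-- Division by the second coordinate: an analytic `F` is `F (x, 0) + y G (x, y)` with `G`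
analytic. -/
lemma exists_eq_add_snd_mul {F : ℂ × ℂ → ℂ} (hF : AnalyticAt ℂ F 0) :
    ∃ G : ℂ × ℂ → ℂ, AnalyticAt ℂ G 0 ∧ ∀ᶠ v in 𝓝 (0 : ℂ × ℂ), F v = F (v.1, 0) + v.2 * G v := by
  obtain ⟨p, r, hp⟩ := hF
  let q : FormalMultilinearSeries ℂ (ℂ × ℂ) ℂ := fun n => quotientTerm (p (n + 1))
  obtain ⟨s, hs0, hsr⟩ := ENNReal.lt_iff_exists_nnreal_btwn.1 hp.r_pos
  have hs0' : 0 < s := by exact_mod_cast hs0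
  obtain ⟨C, hC0, hC⟩ := p.norm_mul_pow_le_of_lt_radius (hsr.trans_le hp.r_le)
  have hq : 0 < q.radius := by
    -- the factor `n + 1` in the norms of the terms is absorbed by halving the radius
    have hb : ((s / 2 : NNReal) : ENNReal) ≤ q.radius := by
      refine q.le_radius_of_bound (C / s) fun n => ?_
      have h1 := norm_quotientTerm_le (p (n + 1))
      have h2 := hC (n + 1)
      have hs0r : (0 : ℝ) < s := hs0'
      have h3 : ((n : ℝ) + 1) ≤ 2 ^ n := by
        exact_mod_cast Nat.lt_two_pow_self (n := n)
      calc ‖q n‖ * ((s / 2 : NNReal) : ℝ) ^ n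
          ≤ ((n + 1) * ‖p (n + 1)‖) * ((s / 2 : NNReal) : ℝ) ^ n := by gcongr
        _ = ((n + 1) / 2 ^ n) * (‖p (n + 1)‖ * (s : ℝ) ^ (n + 1)) / s := by
            push_cast; rw [div_pow]; field_simp; ring
        _ ≤ 1 * C / s := by
            gcongr
            rw [div_le_one (by positivity)]; exact h3
        _ = C / s := by rw [one_mul]
    refine lt_of_lt_of_le ?_ hb
    exact_mod_cast half_pos hs0'
  have hqs := q.hasFPowerSeriesOnBall hq
  refine ⟨q.sum, hqs.analyticAt, ?_⟩
  have hB : Metric.eball (0 : ℂ × ℂ) (min r q.radius) ∈ 𝓝 (0 : ℂ × ℂ) :=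
    Metric.eball_mem_nhds _ (lt_min hp.r_pos hq)
  filter_upwards [hB] with v hv
  have hv1 : v ∈ Metric.eball (0 : ℂ × ℂ) r := Metric.eball_subset_eball (min_le_left _ _) hv
  have hv2 : v ∈ Metric.eball (0 : ℂ × ℂ) q.radius :=
    Metric.eball_subset_eball (min_le_right _ _) hv
  have hw1 : ((v.1, 0) : ℂ × ℂ) ∈ Metric.eball (0 : ℂ × ℂ) r := by
    rw [Metric.mem_eball] at hv1 ⊢
    refine lt_of_le_of_lt ?_ hv1
    rw [Prod.edist_eq, Prod.edist_eq]
    simp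
  have s1 := hp.hasSum hv1
  have s2 := hp.hasSum hw1
  have s3 := (s1.sub s2)
  have s4 := (hqs.hasSum hv2).mul_left v.2
  simp only [zero_add] at s3 s4
  rw [← hasSum_nat_add_iff' 1] at s3
  simp only [Finset.range_one, Finset.sum_singleton] at s3
  have e : p 0 (fun _ => v) - p 0 (fun _ => (v.1, 0)) = 0 := by
    rw [sub_eq_zero]; congr 1; exact Subsingleton.elim _ _
  rw [e, sub_zero] at s3
  have := s3.unique (s4.congr_fun ?_)
  · rw [← this]; ring
  · intro n
    exact (snd_mul_quotientTerm (p (n + 1)) v).symm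

/-- Taylor expansion in `y` with analytic coefficients and analytic remainder. -/
lemma exists_taylor {F : ℂ × ℂ → ℂ} (hF : AnalyticAt ℂ F 0) (n : ℕ) :
    ∃ (a : ℕ → ℂ → ℂ) (b : ℂ × ℂ → ℂ), (∀ k, AnalyticAt ℂ (a k) 0) ∧ AnalyticAt ℂ b 0 ∧
      ∀ᶠ v in 𝓝 (0 : ℂ × ℂ), F v = ∑ k ∈ Finset.range n, a k v.1 * v.2 ^ k + v.2 ^ n * b v := by
  induction n generalizing F with
  | zero => exact ⟨fun _ _ => 0, F, fun _ => analyticAt_const, hF, by simp⟩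
  | succ n ih =>
    obtain ⟨G, hG, hFG⟩ := exists_eq_add_snd_mul hF
    obtain ⟨a, b, ha, hb, hab⟩ := ih hG
    refine ⟨fun k => Nat.casesOn k (fun x => F (x, 0)) a, b, ?_, hb, ?_⟩
    · rintro (_ | k)
      · exact AnalyticAt.fun_comp (f := fun x : ℂ => (x, (0 : ℂ))) hF (by fun_prop)
      · exact ha k
    · filter_upwards [hFG, hab] with v h1 h2
      rw [h1, h2, Finset.sum_range_succ', mul_add, Finset.mul_sum]
      simp only [pow_zero, mul_one]
      rw [add_comm, add_assoc, add_comm (v.2 * _), ← add_assoc]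
      congr 1
      · congr 1
        exact Finset.sum_congr rfl fun k _ => by ring
      · ring

/-- The derivatives at `0` of `c + y * g y` in terms of those of `g`. -/
lemma iteratedDeriv_succ_of_eq_add_mul {f g : ℂ → ℂ} {c : ℂ} (hg : AnalyticAt ℂ g 0)
    (h : ∀ᶠ y in 𝓝 (0 : ℂ), f y = c + y * g y) (k : ℕ) :
    iteratedDeriv (k + 1) f 0 = (k + 1) * iteratedDeriv k g 0 := by
  have h1 : f =ᶠ[𝓝 0] fun y => c + y * g y := h
  rw [h1.iteratedDeriv_eq]
  have h2 : ∀ m : ℕ, ∀ᶠ y in 𝓝 (0 : ℂ), iteratedDeriv (m + 1) (fun y => c + y * g y) y =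
      (m + 1) * iteratedDeriv m g y + y * iteratedDeriv (m + 1) g y := by
    intro m
    induction m with
    | zero =>
      filter_upwards [hg.eventually_analyticAt] with y hy
      have hy' := hy.differentiableAt
      simp only [zero_add, iteratedDeriv_one, iteratedDeriv_zero]
      rw [deriv_const_add, deriv_fun_mul (by fun_prop) hy']
      simp
    | succ m ih =>
      have ih' := eventually_eventually_nhds.2 ih
      filter_upwards [ih', hg.eventually_analyticAt] with y hy hgy
      rw [iteratedDeriv_succ, Filter.EventuallyEq.deriv_eq hy]
      have d1 : DifferentiableAt ℂ (iteratedDeriv m g) y := by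
        rw [iteratedDeriv_eq_iterate]; exact (hgy.iterated_deriv m).differentiableAt
      have d2 : DifferentiableAt ℂ (iteratedDeriv (m + 1) g) y := by
        rw [iteratedDeriv_eq_iterate]; exact (hgy.iterated_deriv _).differentiableAt
      rw [deriv_fun_add (by fun_prop) (by fun_prop), deriv_const_mul _ d1,
        deriv_fun_mul (by fun_prop) d2, ← iteratedDeriv_succ, ← iteratedDeriv_succ]
      simp
      ring
  have := (h2 k).self_of_nhds
  simpa using this

/-- The coefficients of a Taylor expansion with analytic remainder are the expected ones. -/
lemma iteratedDeriv_of_taylor {f g : ℂ → ℂ} {c : ℕ → ℂ} {n : ℕ} (hg : AnalyticAt ℂ g 0)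
    (h : ∀ᶠ y in 𝓝 (0 : ℂ), f y = ∑ k ∈ Finset.range n, c k * y ^ k + y ^ n * g y) :
    (∀ k < n, iteratedDeriv k f 0 = k.factorial * c k) ∧
      iteratedDeriv n f 0 = n.factorial * g 0 := by
  induction n generalizing f c with
  | zero => simpa using h.self_of_nhds
  | succ n ih =>
    let f₁ : ℂ → ℂ := fun y => ∑ k ∈ Finset.range n, c (k + 1) * y ^ k + y ^ n * g y
    have hf₁ : AnalyticAt ℂ f₁ 0 := by fun_prop
    have hf : ∀ᶠ y in 𝓝 (0 : ℂ), f y = c 0 + y * f₁ y := by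
      filter_upwards [h] with y hy
      rw [hy, Finset.sum_range_succ', mul_add, Finset.mul_sum]
      simp only [pow_zero, mul_one]
      rw [add_comm _ (c 0), add_assoc]
      congr 2
      · exact Finset.sum_congr rfl fun k _ => by ring
      · ring
    obtain ⟨h1, h2⟩ := ih (f := f₁) (c := fun k => c (k + 1)) (Eventually.of_forall fun y => rfl)
    refine ⟨?_, ?_⟩
    · rintro (_ | k) hk
      · simpa using hf.self_of_nhds
      · rw [iteratedDeriv_succ_of_eq_add_mul hf₁ hf, h1 k (by omega), Nat.factorial_succ]
        push_cast; ring
    · rw [iteratedDeriv_succ_of_eq_add_mul hf₁ hf, h2, Nat.factorial_succ]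
      push_cast; ring

/-- Iterated partial derivatives in `y` of an analytic function are analytic. -/
lemma analyticAt_iteratedDeriv_snd {F : ℂ × ℂ → ℂ} (hF : AnalyticAt ℂ F 0) (k : ℕ) :
    AnalyticAt ℂ (fun v : ℂ × ℂ => iteratedDeriv k (fun y => F (v.1, y)) v.2) 0 := by
  induction k with
  | zero => simpa using hF
  | succ k ih =>
    have h1 : AnalyticAt ℂ (fun v : ℂ × ℂ => fderiv ℂ
        (fun v : ℂ × ℂ => iteratedDeriv k (fun y => F (v.1, y)) v.2) v (0, 1)) 0 :=
      (ContinuousLinearMap.apply ℂ ℂ ((0, 1) : ℂ × ℂ)).analyticAt _ |>.comp ih.fderiv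
    refine h1.congr ?_
    filter_upwards [ih.eventually_analyticAt] with v hv
    rw [iteratedDeriv_succ]
    have h2 := hv.differentiableAt.hasFDerivAt
    have h3 : HasDerivAt (fun y : ℂ => ((v.1, y) : ℂ × ℂ)) (0, 1) v.2 :=
      (hasDerivAt_const _ _).prodMk (hasDerivAt_id _)
    exact (HasFDerivAt.comp_hasDerivAt (f := fun y : ℂ => ((v.1, y) : ℂ × ℂ)) v.2 h2 h3).deriv.symm

/-- The analytic implicit function theorem for a function of two complex variables. -/
lemma exists_implicit {E : ℂ × ℂ → ℂ} (hE : AnalyticAt ℂ E 0) (h0 : E 0 = 0)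
    (h1 : deriv (fun y => E (0, y)) 0 ≠ 0) :
    ∃ ψ : ℂ → ℂ, AnalyticAt ℂ ψ 0 ∧ ψ 0 = 0 ∧ ∀ᶠ x in 𝓝 (0 : ℂ), E (x, ψ x) = 0 := by
  have cdf : ContDiffAt ℂ ⊤ E 0 := hE.contDiffAt
  have e1 : (fderiv ℂ E 0 ∘L .inr ℂ ℂ ℂ) = ContinuousLinearMap.toSpanSingleton ℂ
      (deriv (fun y => E (0, y)) 0) := by
    ext
    have h3 : HasDerivAt (fun y : ℂ => ((0, y) : ℂ × ℂ)) (0, 1) 0 :=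
      (hasDerivAt_const _ _).prodMk (hasDerivAt_id _)
    have h2 : HasFDerivAt E (fderiv ℂ E 0) ((0 : ℂ), (0 : ℂ)) :=
      hE.differentiableAt.hasFDerivAt
    have := (HasFDerivAt.comp_hasDerivAt (f := fun y : ℂ => ((0, y) : ℂ × ℂ)) 0 h2 h3).deriv
    simp only [ContinuousLinearMap.comp_apply, ContinuousLinearMap.inr_apply,
      ContinuousLinearMap.toSpanSingleton_apply, one_smul]
    rw [← this]; rfl
  have if₂ : (fderiv ℂ E 0 ∘L .inr ℂ ℂ ℂ).IsInvertible := by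
    rw [e1]
    exact ⟨ContinuousLinearEquiv.unitsEquivAut ℂ (Units.mk0 _ h1), by ext; simp⟩
  refine ⟨cdf.implicitFunction (by simp) if₂, ?_, ?_, ?_⟩
  · exact (cdf.contDiffAt_implicitFunction (by simp) if₂).analyticAt
  · exact cdf.implicitFunction_apply_self (by simp) if₂
  · have := cdf.eventually_apply_implicitFunction (by simp) if₂
    rw [h0] at this
    exact this

/-! ### The Newton–Puiseux theorem -/

/-- The Tschirnhaus shift: after a translation `y ↦ y + ψ x`, the Taylor expansion in `y` of a
function of order `d` in `y` has no term of degree `d - 1`. -/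
lemma exists_tschirnhaus {F : ℂ × ℂ → ℂ} (hF : AnalyticAt ℂ F 0) {d : ℕ} (hd : 1 ≤ d)
    (hord : analyticOrderAt (fun y => F (0, y)) 0 = d) :
    ∃ (ψ : ℂ → ℂ) (a : ℕ → ℂ → ℂ) (b : ℂ × ℂ → ℂ), AnalyticAt ℂ ψ 0 ∧ ψ 0 = 0 ∧
      (∀ k, AnalyticAt ℂ (a k) 0) ∧ AnalyticAt ℂ b 0 ∧ (∀ k < d, a k 0 = 0) ∧ b 0 ≠ 0 ∧
      (∀ᶠ x in 𝓝 (0 : ℂ), a (d - 1) x = 0) ∧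
      ∀ᶠ v in 𝓝 (0 : ℂ × ℂ), F (v.1, v.2 + ψ v.1) =
        ∑ k ∈ Finset.range d, a k v.1 * v.2 ^ k + v.2 ^ d * b v := by
  have hF0 : AnalyticAt ℂ (fun y => F (0, y)) 0 :=
    AnalyticAt.fun_comp (f := fun y : ℂ => ((0 : ℂ), y)) hF (by fun_prop)
  rw [analyticOrderAt_eq_nat_iff_iteratedDeriv_eq_zero hF0] at hord
  obtain ⟨hlt, hne⟩ := hord
  obtain ⟨ψ, hψ, hψ0, hEψ⟩ := exists_implicit (analyticAt_iteratedDeriv_snd hF (d - 1))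
    (by simpa using hlt (d - 1) (by omega))
    (by
      have : deriv (fun y => iteratedDeriv (d - 1) (fun y => F (0, y)) y) 0 =
          iteratedDeriv d (fun y => F (0, y)) 0 := by
        rw [← iteratedDeriv_succ]; congr 1; omega
      simpa [this] using hne)
  have hF₁ : AnalyticAt ℂ (fun v : ℂ × ℂ => F (v.1, v.2 + ψ v.1)) 0 := by
    refine AnalyticAt.fun_comp (f := fun v : ℂ × ℂ => (v.1, v.2 + ψ v.1)) ?_ ?_
    · simpa [hψ0] using! hF
    · have : AnalyticAt ℂ (fun v : ℂ × ℂ => ψ v.1) 0 :=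
        AnalyticAt.fun_comp (f := fun v : ℂ × ℂ => v.1) hψ (by fun_prop)
      fun_prop
  obtain ⟨a, b, ha, hb, hab⟩ := exists_taylor hF₁ d
  have htaylor : ∀ᶠ x in 𝓝 (0 : ℂ),
      (∀ k < d, iteratedDeriv k (fun y => F (x, y + ψ x)) 0 = k.factorial * a k x) ∧
        iteratedDeriv d (fun y => F (x, y + ψ x)) 0 = d.factorial * b (x, 0) := by
    have hab' : ∀ᶠ v in 𝓝 (0 : ℂ) ×ˢ 𝓝 (0 : ℂ), F (v.1, v.2 + ψ v.1) =
        ∑ k ∈ Finset.range d, a k v.1 * v.2 ^ k + v.2 ^ d * b v := by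
      rw [← nhds_prod_eq]; exact hab
    have hb' : ∀ᶠ x in 𝓝 (0 : ℂ), AnalyticAt ℂ b (x, 0) := by
      have : Tendsto (fun x : ℂ => (x, (0 : ℂ))) (𝓝 0) (𝓝 0) :=
        (Continuous.prodMk_left (0 : ℂ)).tendsto 0
      exact this.eventually hb.eventually_analyticAt
    filter_upwards [hab'.curry, hb'] with x hx hbx
    exact iteratedDeriv_of_taylor (f := fun y => F (x, y + ψ x)) (g := fun y => b (x, y))
      (c := fun k => a k x)
      (AnalyticAt.fun_comp (f := fun y : ℂ => (x, y)) hbx (by fun_prop)) hx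
  have h0 := htaylor.self_of_nhds
  simp only [hψ0, add_zero] at h0
  refine ⟨ψ, a, b, hψ, hψ0, ha, hb, fun k hk => ?_, ?_, ?_, hab⟩
  · have := h0.1 k hk
    rw [hlt k hk] at this
    exact (mul_eq_zero.1 this.symm).resolve_left (by exact_mod_cast k.factorial_ne_zero)
  · intro hb0
    have := h0.2
    rw [show b (0, 0) = 0 from hb0, mul_zero] at this
    exact hne this
  · filter_upwards [htaylor, hEψ] with x hx hE
    have := hx.1 (d - 1) (by omega)
    rw [iteratedDeriv_comp_add_const (d - 1) (fun y => F (x, y)) (ψ x)] at this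
    simp only [zero_add] at this
    rw [hE] at this
    exact (mul_eq_zero.1 this.symm).resolve_left (by exact_mod_cast (d - 1).factorial_ne_zero)

/-- The choice of a slope of the Newton polygon: substituting `x = t ^ n` makes `a k` divisible by
`t ^ (m * (d - k))` for all `k < d`, with a quotient that does not vanish at `0` for some `k`. -/
lemma exists_newton_slope {d : ℕ} {a : ℕ → ℂ → ℂ} (ha : ∀ k, AnalyticAt ℂ (a k) 0)
    (ha0 : ∀ k < d, a k 0 = 0) (hne : ∃ k < d, ¬ ∀ᶠ x in 𝓝 (0 : ℂ), a k x = 0) :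
    ∃ (m n : ℕ) (c : ℕ → ℂ → ℂ), 0 < m ∧ 0 < n ∧ (∀ k < d, AnalyticAt ℂ (c k) 0) ∧
      (∃ k < d, c k 0 ≠ 0) ∧ (∀ k < d, (∀ᶠ x in 𝓝 (0 : ℂ), a k x = 0) → c k 0 = 0) ∧
      ∀ k < d, ∀ᶠ t in 𝓝 (0 : ℂ), a k (t ^ n) = t ^ (m * (d - k)) * c k t := by
  classical
  let S := (Finset.range d).filter fun k => analyticOrderAt (a k) 0 ≠ ⊤
  have hS : S.Nonempty := by
    obtain ⟨k, hk, hk'⟩ := hne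
    refine ⟨k, ?_⟩
    rw [Finset.mem_filter, Finset.mem_range, ne_eq, analyticOrderAt_eq_top]
    exact ⟨hk, hk'⟩
  let o : ℕ → ℕ := fun k => analyticOrderNatAt (a k) 0
  obtain ⟨k₀, hk₀S, hmin⟩ := S.exists_min_image (fun k => (o k : ℚ) / ((d - k : ℕ) : ℚ)) hS
  have hk₀ : k₀ < d ∧ analyticOrderAt (a k₀) 0 ≠ ⊤ := by simpa [S] using hk₀S
  have hn : 0 < d - k₀ := by omega
  have hmul : ∀ k ∈ S, o k₀ * (d - k) ≤ (d - k₀) * o k := by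
    intro k hk
    have hkd : 0 < d - k := by
      have : k < d ∧ analyticOrderAt (a k) 0 ≠ ⊤ := by simpa [S] using hk
      omega
    have := hmin k hk
    rw [div_le_div_iff₀ (by exact_mod_cast hn) (by exact_mod_cast hkd)] at this
    rw [mul_comm (d - k₀)]
    exact_mod_cast this
  have hm : 0 < o k₀ := by
    rw [Nat.pos_iff_ne_zero]
    intro h
    have h1 : analyticOrderAt (a k₀) 0 = 0 := by
      rw [← Nat.cast_analyticOrderNatAt hk₀.2]; simpa [o] using h
    exact ((ha k₀).analyticOrderAt_eq_zero.1 h1) (ha0 k₀ hk₀.1)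
  have hc : ∀ k, ∃ c : ℂ → ℂ, k < d → AnalyticAt ℂ c 0 ∧ (k = k₀ → c 0 ≠ 0) ∧
      ((∀ᶠ x in 𝓝 (0 : ℂ), a k x = 0) → c 0 = 0) ∧
      ∀ᶠ t in 𝓝 (0 : ℂ), a k (t ^ (d - k₀)) = t ^ (o k₀ * (d - k)) * c t := by
    intro k
    have hpow : Tendsto (fun t : ℂ => t ^ (d - k₀)) (𝓝 0) (𝓝 0) := by
      have := (continuous_pow (M := ℂ) (d - k₀)).tendsto 0
      rwa [zero_pow hn.ne'] at this
    by_cases htop : analyticOrderAt (a k) 0 = ⊤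
    · refine ⟨fun _ => 0, fun _ => ⟨analyticAt_const, ?_, fun _ => rfl, ?_⟩⟩
      · rintro rfl; exact absurd htop hk₀.2
      · filter_upwards [hpow.eventually (analyticOrderAt_eq_top.1 htop)] with t ht
        rw [ht, mul_zero]
    · obtain ⟨e, he, he0, hae⟩ := (ha k).analyticOrderAt_ne_top.1 htop
      refine ⟨fun t => t ^ ((d - k₀) * o k - o k₀ * (d - k)) * e (t ^ (d - k₀)), fun hkd =>
        ⟨?_, ?_, ?_, ?_⟩⟩
      · have : AnalyticAt ℂ (fun t : ℂ => e (t ^ (d - k₀))) 0 :=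
          AnalyticAt.fun_comp (f := fun t : ℂ => t ^ (d - k₀)) (by rwa [zero_pow hn.ne'])
            (by fun_prop)
        exact (analyticAt_id.pow _).fun_mul this
      · rintro rfl
        have e1 : (d - k) * o k - o k * (d - k) = 0 := by rw [mul_comm]; omega
        simp only [e1, pow_zero, one_mul, zero_pow hn.ne']
        exact he0
      · intro h
        exact absurd (analyticOrderAt_eq_top.2 h) htop
      · filter_upwards [hpow.eventually hae] with t ht
        rw [ht, sub_zero, ← pow_mul, smul_eq_mul, ← mul_assoc, ← pow_add]
        congr 2
        have := hmul k (by simp [S, hkd, htop])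
        simp only [o] at this ⊢
        omega
  choose c hc using hc
  exact ⟨o k₀, d - k₀, c, hm, hn, fun k hk => (hc k hk).1, ⟨k₀, hk₀.1, (hc k₀ hk₀.1).2.1 rfl⟩,
    fun k hk => (hc k hk).2.2.1, fun k hk => (hc k hk).2.2.2⟩

/-- A polynomial of degree `d` without term of degree `d - 1`, but with some other term of degree
less than `d`, has a root of multiplicity less than `d`. -/
lemma exists_root_of_multiplicity_lt {d : ℕ} {P : Polynomial ℂ} (hdeg : P.natDegree = d)
    (hd1 : P.coeff (d - 1) = 0) (hk : ∃ k < d, P.coeff k ≠ 0) :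
    ∃ (z₀ : ℂ) (e : ℕ) (R : Polynomial ℂ), 1 ≤ e ∧ e < d ∧ R.eval z₀ ≠ 0 ∧
      P = (Polynomial.X - Polynomial.C z₀) ^ e * R := by
  obtain ⟨k, hkd, hk⟩ := hk
  have hP : P ≠ 0 := by rintro rfl; simp at hk
  obtain ⟨z₀, hz₀⟩ := IsAlgClosed.exists_root P (by
    rw [Polynomial.degree_eq_natDegree hP, hdeg]; exact_mod_cast (by omega : d ≠ 0))
  obtain ⟨R, hR, hRd⟩ := Polynomial.exists_eq_pow_rootMultiplicity_mul_and_not_dvd P hP z₀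
  have hR0 : R ≠ 0 := by rintro rfl; simp at hRd
  have hpos := (Polynomial.rootMultiplicity_pos hP).2 hz₀
  generalize P.rootMultiplicity z₀ = e at hR hpos
  have hsum : d = e + R.natDegree := by
    rw [← hdeg, hR, Polynomial.natDegree_mul (pow_ne_zero _ (Polynomial.X_sub_C_ne_zero z₀)) hR0,
      Polynomial.natDegree_pow, Polynomial.natDegree_X_sub_C, mul_one]
  refine ⟨z₀, e, R, hpos, ?_, fun h => hRd (Polynomial.dvd_iff_isRoot.2 h), hR⟩
  by_contra hlt
  have hed : e = d := by omega
  have hRc : R = Polynomial.C (R.coeff 0) := Polynomial.eq_C_of_natDegree_eq_zero (by omega)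
  have hr : R.coeff 0 ≠ 0 := by intro h; rw [h] at hRc; exact hR0 (by simpa using hRc)
  rw [hRc, hed] at hR
  have hz : z₀ = 0 := by
    rw [hR, Polynomial.coeff_mul_C, sub_eq_add_neg, ← Polynomial.C_neg,
      Polynomial.coeff_X_add_C_pow] at hd1
    have e1 : d - (d - 1) = 1 := by omega
    have e2 : d.choose (d - 1) = d := by
      have := Nat.choose_symm (n := d) (k := 1) (by omega)
      rw [this, Nat.choose_one_right]
    rw [e1, e2] at hd1
    have hd0 : (d : ℂ) ≠ 0 := by exact_mod_cast (by omega : d ≠ 0)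
    simpa [hr, hd0] using hd1
  apply hk
  rw [hR, hz, Polynomial.coeff_mul_C]
  simp [Polynomial.coeff_X_pow, hkd.ne]

/-- The **Newton–Puiseux theorem**: an analytic function of order `d ≥ 1` in `y` vanishes along an
analytic arc `t ↦ (t ^ N, φ t)`. The order in `y` drops in each step of the Newton polygon
construction, because the Tschirnhaus shift excludes a `d`-fold root of the initial polynomial. -/
theorem exists_puiseux_root {d : ℕ} (hd : 1 ≤ d) {F : ℂ × ℂ → ℂ} (hF : AnalyticAt ℂ F 0)
    (hord : analyticOrderAt (fun y => F (0, y)) 0 = d) :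
    ∃ (N : ℕ) (φ : ℂ → ℂ), 0 < N ∧ AnalyticAt ℂ φ 0 ∧ φ 0 = 0 ∧
      ∀ᶠ t in 𝓝 (0 : ℂ), F (t ^ N, φ t) = 0 := by
  induction d using Nat.strong_induction_on generalizing F with
  | _ d ih =>
  obtain ⟨ψ, a, b, hψ, hψ0, ha, hb, ha0, hb0, had, hab⟩ := exists_tschirnhaus hF hd hord
  -- it suffices to find a root after the shift
  suffices H : ∃ (N : ℕ) (φ : ℂ → ℂ), 0 < N ∧ AnalyticAt ℂ φ 0 ∧ φ 0 = 0 ∧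
      ∀ᶠ t in 𝓝 (0 : ℂ), F (t ^ N, φ t + ψ (t ^ N)) = 0 by
    obtain ⟨N, φ, hN, hφ, hφ0, h⟩ := H
    have : AnalyticAt ℂ (fun t : ℂ => ψ (t ^ N)) 0 :=
      AnalyticAt.fun_comp (f := fun t : ℂ => t ^ N) (by rwa [zero_pow hN.ne']) (by fun_prop)
    exact ⟨N, fun t => φ t + ψ (t ^ N), hN, hφ.fun_add this, by simp [hφ0, hN.ne', hψ0], h⟩
  by_cases hne : ∃ k < d, ¬ ∀ᶠ x in 𝓝 (0 : ℂ), a k x = 0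
  swap
  · -- all coefficients vanish: `y = 0` is a root
    push Not at hne
    refine ⟨1, fun _ => 0, one_pos, analyticAt_const, rfl, ?_⟩
    have h1 : Tendsto (fun t : ℂ => (t, (0 : ℂ))) (𝓝 0) (𝓝 0) :=
      (Continuous.prodMk_left (0 : ℂ)).tendsto 0
    filter_upwards [h1.eventually hab, hne 0 (by omega)] with t ht h0
    simp only [pow_one]
    rw [ht, zero_pow (by omega), zero_mul, add_zero]
    refine Finset.sum_eq_zero fun k _ => ?_
    rcases Nat.eq_zero_or_pos k with rfl | hk
    · simp [h0]
    · simp [hk.ne']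
  obtain ⟨m, n, c, hm, hn, hc, hk₀, hczero, hac⟩ := exists_newton_slope ha ha0 hne
  let P : Polynomial ℂ := ∑ k ∈ Finset.range d, Polynomial.monomial k (c k 0) +
    Polynomial.monomial d (b 0)
  have hcoeff : ∀ k < d, P.coeff k = c k 0 := by
    intro k hk
    simp [P, Polynomial.coeff_monomial, Finset.sum_ite_eq', hk, hk.ne']
  have hcoeffd : P.coeff d = b 0 := by
    simp [P, Polynomial.coeff_monomial, Finset.sum_ite_eq']
  have hdeg : P.natDegree = d := by
    refine Polynomial.natDegree_eq_of_le_of_coeff_ne_zero ?_ (by rwa [hcoeffd])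
    rw [Polynomial.natDegree_le_iff_coeff_eq_zero]
    intro k hk
    have h1 : k ≠ d := by omega
    simp [P, Polynomial.coeff_monomial, Finset.sum_ite_eq', h1.symm, hk.le]
  obtain ⟨z₀, e, R, he1, hed, hRz, hPR⟩ := exists_root_of_multiplicity_lt hdeg
    (by rw [hcoeff _ (by omega)]; exact hczero _ (by omega) had)
    (by obtain ⟨k, hk, h⟩ := hk₀; exact ⟨k, hk, by rwa [hcoeff k hk]⟩)
  -- the strict transform of the shifted function at the point `z₀`
  let G : ℂ × ℂ → ℂ := fun v => ∑ k ∈ Finset.range d, c k v.1 * (z₀ + v.2) ^ k +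
    (z₀ + v.2) ^ d * b (v.1 ^ n, v.1 ^ m * (z₀ + v.2))
  have hG : AnalyticAt ℂ G 0 := by
    have h1 : ∀ k ∈ Finset.range d, AnalyticAt ℂ (fun v : ℂ × ℂ => c k v.1 * (z₀ + v.2) ^ k) 0 := by
      intro k hk
      have : AnalyticAt ℂ (fun v : ℂ × ℂ => c k v.1) 0 :=
        AnalyticAt.fun_comp (f := fun v : ℂ × ℂ => v.1) (hc k (Finset.mem_range.1 hk)) (by fun_prop)
      exact this.fun_mul (by fun_prop)
    have h2 : AnalyticAt ℂ (fun v : ℂ × ℂ => b (v.1 ^ n, v.1 ^ m * (z₀ + v.2))) 0 := by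
      refine AnalyticAt.fun_comp (f := fun v : ℂ × ℂ => (v.1 ^ n, v.1 ^ m * (z₀ + v.2))) ?_
        (by fun_prop)
      simpa [hn.ne', hm.ne'] using! hb
    have h3 : AnalyticAt ℂ (fun v : ℂ × ℂ => (z₀ + v.2) ^ d) 0 := by fun_prop
    exact (Finset.analyticAt_fun_sum _ h1).fun_add (h3.fun_mul h2)
  have hGP : ∀ w, G (0, w) = P.eval (z₀ + w) := by
    intro w
    simp only [G, P, Polynomial.eval_add, Polynomial.eval_finsetSum, Polynomial.eval_monomial,
      zero_pow hn.ne', zero_pow hm.ne', zero_mul]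
    rw [show b (0, 0) = b 0 from rfl, mul_comm (b 0)]
  have hGord : analyticOrderAt (fun w => G (0, w)) 0 = e := by
    have hG0 : AnalyticAt ℂ (fun w => G (0, w)) 0 :=
      AnalyticAt.fun_comp (f := fun y : ℂ => ((0 : ℂ), y)) hG (by fun_prop)
    rw [hG0.analyticOrderAt_eq_natCast]
    refine ⟨fun w => R.eval (z₀ + w), ?_, by simpa using hRz, Eventually.of_forall fun w => ?_⟩
    · have : AnalyticAt ℂ (fun w : ℂ => z₀ + w) 0 := by fun_prop
      simpa using this.aeval_polynomial R
    · rw [hGP, hPR]; simp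
  obtain ⟨N, φ, hN, hφ, hφ0, hroot⟩ := ih e hed he1 hG hGord
  refine ⟨N * n, fun s => s ^ (N * m) * (z₀ + φ s), by positivity, by fun_prop,
    by simp [hN.ne', hm.ne'], ?_⟩
  have hpow : Tendsto (fun t : ℂ => t ^ N) (𝓝 0) (𝓝 0) := by
    have := (continuous_pow (M := ℂ) N).tendsto 0
    rwa [zero_pow hN.ne'] at this
  have hlim : Tendsto (fun s : ℂ => (s ^ (N * n), s ^ (N * m) * (z₀ + φ s))) (𝓝 0) (𝓝 0) := by
    have h1 : ContinuousAt (fun s : ℂ => (s ^ (N * n), s ^ (N * m) * (z₀ + φ s))) 0 := by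
      have := hφ.continuousAt
      fun_prop
    have h2 := h1.tendsto
    simpa [hN.ne', hn.ne', hm.ne'] using! h2
  have hac' : ∀ᶠ t in 𝓝 (0 : ℂ), ∀ k ∈ Finset.range d,
      a k (t ^ n) = t ^ (m * (d - k)) * c k t := by
    rw [Filter.eventually_all_finset]
    exact fun k hk => hac k (Finset.mem_range.1 hk)
  filter_upwards [hroot, hlim.eventually hab, hpow.eventually hac'] with s h1 h2 h3
  rw [h2]
  have h4 : ∑ k ∈ Finset.range d, a k (s ^ (N * n)) * (s ^ (N * m) * (z₀ + φ s)) ^ k +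
      (s ^ (N * m) * (z₀ + φ s)) ^ d * b (s ^ (N * n), s ^ (N * m) * (z₀ + φ s)) =
      s ^ (N * m * d) * G (s ^ N, φ s) := by
    simp only [G]
    rw [mul_add (s ^ (N * m * d)), Finset.mul_sum]
    congr 1
    · refine Finset.sum_congr rfl fun k hk => ?_
      rw [pow_mul s N n, h3 k hk, mul_pow, ← pow_mul, ← pow_mul]
      have hkd := Finset.mem_range.1 hk
      have e1 : N * m * d = N * (m * (d - k)) + N * m * k := by
        conv_lhs => rw [← Nat.sub_add_cancel hkd.le]
        ring
      rw [e1, pow_add]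
      ring
    · rw [← pow_mul, ← pow_mul, mul_pow, ← pow_mul]
      ring
  rw [h4, h1, mul_zero]

/-- Near the origin, after a substitution `x = t ^ N`, the zero set of an analytic function that
is not identically zero on the `y`-axis is a finite union of graphs `y = φ t`. -/
theorem exists_puiseux_roots {d : ℕ} {F : ℂ × ℂ → ℂ} (hF : AnalyticAt ℂ F 0)
    (hord : analyticOrderAt (fun y => F (0, y)) 0 = d) :
    ∃ (N : ℕ) (l : List (ℂ → ℂ)), 0 < N ∧ (∀ φ ∈ l, AnalyticAt ℂ φ 0 ∧ φ 0 = 0) ∧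
      ∀ᶠ v in 𝓝 (0 : ℂ × ℂ), F (v.1 ^ N, v.2) = 0 ↔ ∃ φ ∈ l, v.2 = φ v.1 := by
  induction d generalizing F with
  | zero =>
    have hF0 : F 0 ≠ 0 := by
      have h1 : AnalyticAt ℂ (fun y => F (0, y)) 0 :=
        AnalyticAt.fun_comp (f := fun y : ℂ => ((0 : ℂ), y)) hF (by fun_prop)
      exact h1.analyticOrderAt_eq_zero.1 (by simpa using hord)
    refine ⟨1, [], one_pos, by simp, ?_⟩
    filter_upwards [hF.continuousAt.eventually_ne hF0] with v hv
    simpa using! hv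
  | succ d ih =>
    obtain ⟨N, φ, hN, hφ, hφ0, hroot⟩ := exists_puiseux_root (Nat.succ_pos d) hF hord
    have hφ' : AnalyticAt ℂ (fun v : ℂ × ℂ => φ v.1) 0 :=
      AnalyticAt.fun_comp (f := fun v : ℂ × ℂ => v.1) hφ (by fun_prop)
    have hF₁ : AnalyticAt ℂ (fun v : ℂ × ℂ => F (v.1 ^ N, v.2 + φ v.1)) 0 := by
      refine AnalyticAt.fun_comp (f := fun v : ℂ × ℂ => (v.1 ^ N, v.2 + φ v.1)) ?_ (by fun_prop)
      simpa [hφ0, hN.ne'] using! hF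
    obtain ⟨G, hG, hFG⟩ := exists_eq_add_snd_mul hF₁
    let H : ℂ × ℂ → ℂ := fun v => G (v.1, v.2 - φ v.1)
    have hH : AnalyticAt ℂ H 0 := by
      refine AnalyticAt.fun_comp (f := fun v : ℂ × ℂ => (v.1, v.2 - φ v.1)) ?_ (by fun_prop)
      simpa [hφ0] using! hG
    have hlim : Tendsto (fun v : ℂ × ℂ => (v.1, v.2 - φ v.1)) (𝓝 0) (𝓝 0) := by
      have h1 : ContinuousAt (fun v : ℂ × ℂ => (v.1, v.2 - φ v.1)) 0 := by
        have := hφ'.continuousAt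
        fun_prop
      simpa [hφ0] using! h1.tendsto
    have hfst : Tendsto (fun v : ℂ × ℂ => v.1) (𝓝 0) (𝓝 0) := continuous_fst.tendsto _
    have hFH : ∀ᶠ v in 𝓝 (0 : ℂ × ℂ), F (v.1 ^ N, v.2) = (v.2 - φ v.1) * H v := by
      filter_upwards [hlim.eventually hFG, hfst.eventually hroot] with v h1 h2
      simp only [sub_add_cancel, zero_add] at h1
      rw [h1, h2, zero_add]
    have hH0 : analyticOrderAt (fun y => H (0, y)) 0 = d := by
      have h0 : AnalyticAt ℂ (fun y => H (0, y)) 0 :=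
        AnalyticAt.fun_comp (f := fun y : ℂ => ((0 : ℂ), y)) hH (by fun_prop)
      have h1 : Tendsto (fun y : ℂ => ((0 : ℂ), y)) (𝓝 0) (𝓝 0) :=
        (Continuous.prodMk_right (0 : ℂ)).tendsto 0
      have h2 : (fun y => F (0, y)) =ᶠ[𝓝 0] ((fun y => y) * fun y => H (0, y)) := by
        filter_upwards [h1.eventually hFH] with y hy
        simpa [hφ0, hN.ne'] using hy
      rw [analyticOrderAt_congr h2, analyticOrderAt_mul (by fun_prop) h0] at hord
      have h3 : analyticOrderAt (fun y : ℂ => y) 0 = 1 := analyticOrderAt_id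
      rw [h3] at hord
      push_cast at hord
      rw [add_comm] at hord
      exact ENat.add_left_injective_of_ne_top ENat.one_ne_top hord
    obtain ⟨M, l, hM, hl, hroots⟩ := ih hH hH0
    refine ⟨M * N, (fun s => φ (s ^ M)) :: l, by positivity, ?_, ?_⟩
    · intro χ hχ
      rcases List.mem_cons.1 hχ with rfl | hχ
      · exact ⟨AnalyticAt.fun_comp (f := fun t : ℂ => t ^ M) (by rwa [zero_pow hM.ne'])
          (by fun_prop), by simp [hM.ne', hφ0]⟩
      · exact hl χ (by simpa using hχ)
    · have hpow : Tendsto (fun v : ℂ × ℂ => (v.1 ^ M, v.2)) (𝓝 0) (𝓝 0) := by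
        have h1 : Continuous (fun v : ℂ × ℂ => (v.1 ^ M, v.2)) := by fun_prop
        simpa [hM.ne'] using! h1.tendsto 0
      filter_upwards [hroots, hpow.eventually hFH] with v h1 h2
      rw [pow_mul, h2, mul_eq_zero, h1, sub_eq_zero]
      simp

/-! ### Parametrized branches -/

/-- All `N`-th roots of a small number are small. -/
lemma eventually_forall_pow_eq {N : ℕ} {P : ℂ → Prop} (h : ∀ᶠ t in 𝓝 (0 : ℂ), P t) :
    ∀ᶠ x in 𝓝 (0 : ℂ), ∀ t : ℂ, t ^ N = x → P t := by
  obtain ⟨ε, hε, hP⟩ := Metric.eventually_nhds_iff.1 h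
  refine Metric.eventually_nhds_iff.2 ⟨ε ^ N, by positivity, fun x hx t ht => hP ?_⟩
  rw [dist_zero_right] at hx ⊢
  rw [← ht, norm_pow] at hx
  exact lt_of_pow_lt_pow_left₀ N hε.le hx

lemma eventually_forall_pow_eq_fst {N : ℕ} {P : ℂ × ℂ → Prop}
    (h : ∀ᶠ v in 𝓝 (0 : ℂ × ℂ), P v) :
    ∀ᶠ v in 𝓝 (0 : ℂ × ℂ), ∀ t : ℂ, t ^ N = v.1 → P (t, v.2) := by
  have h' : ∀ᶠ v in 𝓝 (0 : ℂ) ×ˢ 𝓝 (0 : ℂ), P v := by rw [← nhds_prod_eq]; exact h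
  obtain ⟨pa, ha, pb, hb, hab⟩ := Filter.eventually_prod_iff.1 h'
  have h1 : Tendsto (fun v : ℂ × ℂ => v.1) (𝓝 0) (𝓝 0) := continuous_fst.tendsto _
  have h2 : Tendsto (fun v : ℂ × ℂ => v.2) (𝓝 0) (𝓝 0) := continuous_snd.tendsto _
  filter_upwards [h1.eventually (eventually_forall_pow_eq ha), h2.eventually hb] with v hv1 hv2 t ht
  exact hab (hv1 t ht) hv2

/-- `y = φ t`, `x = t ^ N` is a convergent Puiseux parametrization whose tangent at the origin is
not the `y`-axis. -/
structure IsPuiseux (N : ℕ) (φ : ℂ → ℂ) : Prop where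
  pos : 0 < N
  analyticAt : AnalyticAt ℂ φ 0
  isBigO : φ =O[𝓝 0] fun t => t ^ N

lemma IsPuiseux.map_zero {N : ℕ} {φ : ℂ → ℂ} (h : IsPuiseux N φ) : φ 0 = 0 := by
  obtain ⟨C, hC⟩ := h.isBigO.bound
  simpa [h.pos.ne'] using hC.self_of_nhds

/-- The arc `t ↦ (t ^ N, φ t)` in the linear coordinates given by `L`. -/
noncomputable def arc (L : (ℂ × ℂ) ≃L[ℂ] C2) (N : ℕ) (φ : ℂ → ℂ) (t : ℂ) : C2 := L (t ^ N, φ t)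

/-- The set parametrized by `arc L N φ`. Only its germ at `0` is of interest; since `t` is small
when `t ^ N` is (for `N > 0`), this germ depends only on the germ of `φ`. -/
def branch (L : (ℂ × ℂ) ≃L[ℂ] C2) (N : ℕ) (φ : ℂ → ℂ) : Set C2 := Set.range (arc L N φ)

variable {L : (ℂ × ℂ) ≃L[ℂ] C2} {N : ℕ} {φ χ : ℂ → ℂ}

lemma arc_zero (h : IsPuiseux N φ) : arc L N φ 0 = 0 := by
  simp [arc, h.map_zero, h.pos.ne']

lemma arc_ne_zero (h : IsPuiseux N φ) {t : ℂ} (ht : t ≠ 0) : arc L N φ t ≠ 0 := by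
  have := h.pos
  simp [arc, ht]

lemma continuousAt_arc {t : ℂ} (ht : ContinuousAt φ t) :
    ContinuousAt (arc L N φ) t := by
  unfold arc
  fun_prop

lemma tendsto_arc (h : IsPuiseux N φ) : Tendsto (arc L N φ) (𝓝 0) (𝓝 0) := by
  have := (continuousAt_arc (L := L) (N := N) h.analyticAt.continuousAt).tendsto
  rwa [arc_zero h] at this

lemma analyticAt_arc (h : IsPuiseux N φ) : AnalyticAt ℂ (arc L N φ) 0 := by
  have h1 : AnalyticAt ℂ (fun t : ℂ => (t ^ N, φ t)) 0 :=
    AnalyticAt.prod (by fun_prop) h.analyticAt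
  exact (L.toContinuousLinearMap.analyticAt _).comp h1

lemma tendsto_symm : Tendsto (fun z => L.symm z) (𝓝 0) (𝓝 0) := by
  have := L.symm.continuous.tendsto 0
  rwa [map_zero] at this

lemma tendsto_coe : Tendsto (fun v => L v) (𝓝 0) (𝓝 0) := by
  have := L.continuous.tendsto 0
  rwa [map_zero] at this

/-- The parameters of points of a branch close to `0` are close to `0`. -/
lemma eventually_forall_arc_eq {P : ℂ → Prop} (h : ∀ᶠ t in 𝓝 (0 : ℂ), P t) :
    ∀ᶠ z in 𝓝 (0 : C2), ∀ t : ℂ, arc L N φ t = z → P t := by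
  have h1 : Tendsto (fun z : C2 => (L.symm z).1) (𝓝 0) (𝓝 0) :=
    (continuous_fst.tendsto (0 : ℂ × ℂ)).comp tendsto_symm
  filter_upwards [h1.eventually (eventually_forall_pow_eq (N := N) h)] with z hz t ht
  exact hz t (by rw [← ht]; simp [arc])

lemma branch_le_iff (h : IsPuiseux N φ) {W : Set C2} :
    branch L N φ ≤ᶠ[𝓝 0] W ↔ ∀ᶠ t in 𝓝 (0 : ℂ), arc L N φ t ∈ W := by
  constructor
  · intro hW
    filter_upwards [(tendsto_arc h).eventually hW] with t ht
    exact ht ⟨t, rfl⟩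
  · intro hW
    filter_upwards [eventually_forall_arc_eq (L := L) (φ := φ) hW] with z hz
    rintro ⟨t, rfl⟩
    exact hz t rfl

/-- The lowest homogeneous part of an analytic function dominates the rest. -/
lemma exists_leading_form {f : C2 → ℂ} (hf : AnalyticAt ℂ f 0)
    (hne : ¬ ∀ᶠ z in 𝓝 (0 : C2), f z = 0) :
    ∃ (d : ℕ) (P : C2 [×d]→L[ℂ] ℂ), (∃ v, P (fun _ => v) ≠ 0) ∧
      (fun z => f z - P fun _ => z) =O[𝓝 0] fun z => ‖z‖ ^ (d + 1) := by
  classical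
  obtain ⟨p, hp⟩ := hf
  have hex : ∃ n, ∃ v, p n (fun _ => v) ≠ 0 := by
    by_contra! h
    apply hne
    obtain ⟨r, hr⟩ := hp
    filter_upwards [Metric.eball_mem_nhds _ hr.r_pos] with z hz
    have := hr.hasSum hz
    simp only [h, zero_add] at this
    exact this.unique hasSum_zero
  refine ⟨Nat.find hex, p (Nat.find hex), Nat.find_spec hex, ?_⟩
  have := hp.isBigO_sub_partialSum_pow (Nat.find hex + 1)
  refine this.congr_left fun z => ?_
  rw [zero_add, FormalMultilinearSeries.partialSum, Finset.sum_range_succ, Finset.sum_eq_zero,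
    zero_add]
  intro k hk
  have := Nat.find_min hex (Finset.mem_range.1 hk)
  push Not at this
  exact this z

/-- In suitable linear coordinates, the `y`-axis is not in the tangent cone of a given curve. -/
lemma exists_coordinates {f : C2 → ℂ} (hf : AnalyticAt ℂ f 0) (hf0 : f 0 = 0)
    (hne : ¬ ∀ᶠ z in 𝓝 (0 : C2), f z = 0) :
    ∃ (L : (ℂ × ℂ) ≃L[ℂ] C2) (κ : ℝ), 0 < κ ∧
      ∀ᶠ v in 𝓝 (0 : ℂ × ℂ), f (L v) = 0 → κ * ‖v.2‖ ≤ ‖v.1‖ := by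
  obtain ⟨d, P, ⟨v₀, hv₀⟩, hO⟩ := exists_leading_form hf hne
  have hv₀0 : v₀ ≠ 0 := by
    rintro rfl
    obtain ⟨C, hC⟩ := hO.bound
    have h1 := hC.self_of_nhds
    simp only [hf0, zero_sub, norm_neg, norm_zero, ne_eq, Nat.succ_ne_zero, not_false_eq_true,
      zero_pow, mul_zero, norm_le_zero_iff] at h1
    exact hv₀ h1
  have L₀ : (ℂ × ℂ) ≃L[ℂ] C2 := ContinuousLinearEquiv.ofFinrankEq (by simp)
  obtain ⟨A, hA⟩ := SeparatingDual.exists_continuousLinearEquiv_apply_eq (R := ℂ)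
    (x := L₀ (0, 1)) (y := v₀) (by simp) hv₀0
  let L := L₀.trans A
  have hL : L (0, 1) = v₀ := hA
  let q : ℂ → ℂ := fun s => P fun _ => L (s, 1)
  have hq : Continuous q := by
    have h1 : Continuous fun s : ℂ => L (s, 1) := by fun_prop
    exact P.cont.comp (continuous_pi fun _ => h1)
  have hq0 : 0 < ‖q 0‖ := by simpa [q, hL] using hv₀
  obtain ⟨δ, hδ, hqδ⟩ := Metric.eventually_nhds_iff.1
    (hq.norm.continuousAt.eventually (lt_mem_nhds (half_lt_self hq0)))
  have hO' : (fun v : ℂ × ℂ => f (L v) - P fun _ => L v) =O[𝓝 0] fun v => ‖v‖ ^ (d + 1) := by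
    refine (hO.comp_tendsto (tendsto_coe (L := L))).trans ?_
    refine Asymptotics.IsBigO.pow (Asymptotics.IsBigO.norm_norm ?_) (d + 1)
    exact L.toContinuousLinearMap.isBigO_id _
  obtain ⟨C, hC0, hC⟩ := hO'.exists_pos
  refine ⟨L, min δ 1, by positivity, ?_⟩
  have hsmall : ∀ᶠ v in 𝓝 (0 : ℂ × ℂ), C * ‖v‖ < ‖q 0‖ / 2 := by
    have h1 : Continuous fun v : ℂ × ℂ => C * ‖v‖ := by fun_prop
    have h2 := h1.tendsto 0
    simp only [norm_zero, mul_zero] at h2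
    exact h2.eventually (gt_mem_nhds (half_pos hq0))
  filter_upwards [hC.bound, hsmall] with v h1 h2 h3
  by_contra! h4
  have hy : v.2 ≠ 0 := by
    intro h; rw [h] at h4; simp at h4; linarith [norm_nonneg v.1]
  have hy' : 0 < ‖v.2‖ := norm_pos_iff.2 hy
  have hs : ‖v.1 / v.2‖ < min δ 1 := by rwa [norm_div, div_lt_iff₀ hy']
  have hnorm : ‖v‖ = ‖v.2‖ := by
    rw [Prod.norm_def]
    refine max_eq_right ?_
    calc ‖v.1‖ ≤ min δ 1 * ‖v.2‖ := h4.le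
      _ ≤ 1 * ‖v.2‖ := by gcongr; exact min_le_right _ _
      _ = ‖v.2‖ := one_mul _
  have hv : P (fun _ => L v) = v.2 ^ d * q (v.1 / v.2) := by
    have e : v = v.2 • ((v.1 / v.2, 1) : ℂ × ℂ) := by
      ext
      · simp; field_simp
      · simp
    have e2 : (fun _ : Fin d => L v) = fun i : Fin d => (fun _ => v.2) i • L (v.1 / v.2, 1) := by
      funext i; conv_lhs => rw [e, map_smul]
    rw [e2]
    have := P.map_smul_univ (fun _ => v.2) (fun _ => L (v.1 / v.2, 1))
    rw [this]
    simp [q]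
  have h5 : ‖q 0‖ / 2 < ‖q (v.1 / v.2)‖ := by
    refine hqδ ?_
    rw [dist_zero_right]
    exact hs.trans_le (min_le_left _ _)
  rw [h3, zero_sub, norm_neg, hv, norm_mul, norm_pow, norm_pow, norm_norm, hnorm, pow_succ] at h1
  rw [hnorm] at h2
  have h6 : 0 < ‖v.2‖ ^ d := by positivity
  nlinarith

/-- A plane curve germ is a finite union of parametrized branches. -/
theorem exists_branches {X : Set C2} (hX : IsPlaneCurveGerm X) :
    ∃ (L : (ℂ × ℂ) ≃L[ℂ] C2) (N : ℕ) (l : List (ℂ → ℂ)), (∀ φ ∈ l, IsPuiseux N φ) ∧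
      X =ᶠ[𝓝 (0 : C2)] {z | ∃ φ ∈ l, z ∈ branch L N φ} := by
  obtain ⟨f, hf, hf0, hne, hXf⟩ := hX
  obtain ⟨L, κ, hκ, hcone⟩ := exists_coordinates hf hf0 hne
  let F : ℂ × ℂ → ℂ := fun v => f (L v)
  have hF : AnalyticAt ℂ F 0 := by
    refine AnalyticAt.fun_comp (f := fun v => L v) ?_ (L.toContinuousLinearMap.analyticAt _)
    simpa using hf
  have hF0 : AnalyticAt ℂ (fun y => F (0, y)) 0 :=
    AnalyticAt.fun_comp (f := fun y : ℂ => ((0 : ℂ), y)) hF (by fun_prop)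
  have htop : analyticOrderAt (fun y => F (0, y)) 0 ≠ ⊤ := by
    rw [ne_eq, analyticOrderAt_eq_top]
    intro h
    have h1 : Tendsto (fun y : ℂ => ((0 : ℂ), y)) (𝓝 0) (𝓝 0) :=
      (Continuous.prodMk_right (0 : ℂ)).tendsto 0
    have h2 : ∀ᶠ y in 𝓝 (0 : ℂ), y = 0 := by
      filter_upwards [h, h1.eventually hcone] with y hy hc
      have := hc hy
      simp only [norm_zero] at this
      exact norm_le_zero_iff.1 (nonpos_of_mul_nonpos_right this hκ)
    obtain ⟨y, hy1, hy2⟩ := ((h2.filter_mono nhdsWithin_le_nhds).and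
      (self_mem_nhdsWithin (s := {0}ᶜ))).exists
    exact hy2 hy1
  obtain ⟨d, hd⟩ := ENat.ne_top_iff_exists.1 htop
  obtain ⟨N, l, hN, hl, hroots⟩ := exists_puiseux_roots hF hd.symm
  have hgraph : ∀ φ ∈ l, ∀ᶠ t in 𝓝 (0 : ℂ), F (t ^ N, φ t) = 0 := by
    intro φ hφ
    have h1 : Tendsto (fun t : ℂ => (t, φ t)) (𝓝 0) (𝓝 0) := by
      have h2 : ContinuousAt (fun t : ℂ => (t, φ t)) 0 := by
        have := (hl φ hφ).1.continuousAt
        fun_prop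
      simpa [(hl φ hφ).2] using! h2.tendsto
    filter_upwards [h1.eventually hroots] with t ht
    exact ht.2 ⟨φ, hφ, rfl⟩
  have hpuiseux : ∀ φ ∈ l, IsPuiseux N φ := by
    intro φ hφ
    refine ⟨hN, (hl φ hφ).1, Asymptotics.IsBigO.of_bound κ⁻¹ ?_⟩
    have h1 : Tendsto (fun t : ℂ => (t ^ N, φ t)) (𝓝 0) (𝓝 0) := by
      have h2 : ContinuousAt (fun t : ℂ => (t ^ N, φ t)) 0 := by
        have := (hl φ hφ).1.continuousAt
        fun_prop
      simpa [(hl φ hφ).2, hN.ne'] using! h2.tendsto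
    filter_upwards [hgraph φ hφ, h1.eventually hcone] with t h2 h3
    rw [inv_mul_eq_div, le_div_iff₀ hκ, mul_comm]
    exact h3 h2
  refine ⟨L, N, l, hpuiseux, hXf.trans ?_⟩
  have hle : ∀ᶠ z in 𝓝 (0 : C2), ∀ φ ∈ l, z ∈ branch L N φ → f z = 0 := by
    have : ∀ φ ∈ l, ∀ᶠ z in 𝓝 (0 : C2), z ∈ branch L N φ → f z = 0 := fun φ hφ =>
      (branch_le_iff (hpuiseux φ hφ) (W := {z | f z = 0})).2 (hgraph φ hφ)
    have h2 := (Filter.eventually_all_finite (List.finite_toSet l)).2 this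
    exact h2
  filter_upwards [hle, tendsto_symm.eventually (eventually_forall_pow_eq_fst hroots)] with z h1 h2
  apply propext
  constructor
  · intro hz
    obtain ⟨t, ht⟩ := IsAlgClosed.exists_pow_nat_eq (L.symm z).1 hN
    have h3 : F (t ^ N, (L.symm z).2) = 0 := by
      simp only [F, ht]
      simpa using! hz
    obtain ⟨φ, hφ, h4⟩ := (h2 t ht).1 h3
    refine ⟨φ, hφ, t, ?_⟩
    rw [arc, ht, ← h4]
    simp
  · rintro ⟨φ, hφ, hz⟩
    exact h1 φ hφ hz

/-! ### Branches are analytic germs -/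

/-- An analytic function that is invariant under multiplication by `N`-th roots of unity is an
analytic function of `t ^ N`; analyticity at the origin is Riemann's removable singularity
theorem. -/
lemma exists_eq_comp_pow {N : ℕ} (hN : 0 < N) {c : ℂ → ℂ} (hc : AnalyticAt ℂ c 0)
    (hinv : ∀ ω : ℂ, ω ^ N = 1 → ∀ t, c (ω * t) = c t) :
    ∃ C : ℂ → ℂ, AnalyticAt ℂ C 0 ∧ ∀ t, C (t ^ N) = c t := by
  have hinv' : ∀ s t : ℂ, s ^ N = t ^ N → c s = c t := by
    intro s t hst
    by_cases ht : t = 0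
    · subst ht
      rw [zero_pow hN.ne'] at hst
      rw [pow_eq_zero_iff hN.ne'] at hst
      rw [hst]
    · have := hinv (s / t) (by rw [div_pow, hst, div_self (pow_ne_zero _ ht)]) t
      rwa [div_mul_cancel₀ _ ht] at this
  have hroot : ∀ x : ℂ, (x ^ ((N : ℂ)⁻¹)) ^ N = x := fun x => Complex.cpow_nat_inv_pow x hN.ne'
  let C : ℂ → ℂ := fun x => c (x ^ ((N : ℂ)⁻¹))
  have hC : ∀ t, C (t ^ N) = c t := fun t => hinv' _ _ (hroot _)
  refine ⟨C, ?_, hC⟩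
  refine Complex.analyticAt_of_differentiable_on_punctured_nhds_of_continuousAt ?_ ?_
  · have h1 : ∀ᶠ x in 𝓝 (0 : ℂ), ∀ t : ℂ, t ^ N = x → AnalyticAt ℂ c t :=
      eventually_forall_pow_eq hc.eventually_analyticAt
    filter_upwards [h1.filter_mono nhdsWithin_le_nhds, self_mem_nhdsWithin] with x₀ hx₀ hne
    have hx₀' : x₀ ≠ 0 := hne
    -- a differentiable branch of the root near `x₀`
    have h2 : C = fun x => c (x₀ ^ ((N : ℂ)⁻¹) * (x / x₀) ^ ((N : ℂ)⁻¹)) := by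
      funext x
      refine hinv' _ _ ?_
      rw [mul_pow, hroot, hroot, hroot, mul_div_cancel₀ _ hx₀']
    rw [h2]
    have h3 : DifferentiableAt ℂ (fun x : ℂ => x₀ ^ ((N : ℂ)⁻¹) * (x / x₀) ^ ((N : ℂ)⁻¹)) x₀ := by
      refine (DifferentiableAt.cpow (by fun_prop) (by fun_prop) ?_).const_mul _
      rw [div_self hx₀']
      exact Complex.one_mem_slitPlane
    refine DifferentiableAt.comp (g := c) x₀ (hx₀ _ ?_).differentiableAt h3
    rw [mul_pow, hroot, hroot, mul_div_cancel₀ _ hx₀']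
  · have h0 : C 0 = c 0 := by simpa [hN.ne'] using hC 0
    rw [ContinuousAt, h0]
    intro U hU
    have h1 : ∀ᶠ x in 𝓝 (0 : ℂ), ∀ t : ℂ, t ^ N = x → c t ∈ U :=
      eventually_forall_pow_eq (hc.continuousAt.eventually hU)
    rw [Filter.mem_map]
    filter_upwards [h1] with x hx
    exact hx _ (hroot x)

lemma analyticAt_coeff_prod {ι : Type*} (s : Finset ι) {g : ι → ℂ → ℂ}
    (hg : ∀ i ∈ s, AnalyticAt ℂ (g i) 0) (k : ℕ) :
    AnalyticAt ℂ
      (fun t => (∏ i ∈ s, (Polynomial.X - Polynomial.C (g i t))).coeff k) 0 := by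
  classical
  induction s using Finset.induction_on generalizing k with
  | empty => simpa using analyticAt_const
  | insert a s ha ih =>
    have ih' := fun k => ih (fun i hi => hg i (Finset.mem_insert_of_mem hi)) k
    have hga := hg a (Finset.mem_insert_self a s)
    simp only [Finset.prod_insert ha, sub_mul, Polynomial.coeff_sub, Polynomial.coeff_C_mul]
    cases k with
    | zero =>
      simp only [Polynomial.coeff_X_mul_zero]
      exact analyticAt_const.fun_sub (hga.fun_mul (ih' 0))
    | succ k =>
      simp only [Polynomial.coeff_X_mul]
      exact (ih' k).fun_sub (hga.fun_mul (ih' (k + 1)))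

/-- A branch is the zero set of one analytic function, namely of the norm
`∏_{ζ ^ N = 1} (y - φ (ζ t))` of `y - φ t`, which is analytic in `x = t ^ N` and `y`. -/
lemma exists_branch_eq (h : IsPuiseux N φ) :
    ∃ Q : C2 → ℂ, AnalyticAt ℂ Q 0 ∧ branch L N φ =ᶠ[𝓝 0] {z | Q z = 0} := by
  have hN := h.pos
  let S := Polynomial.nthRootsFinset N (1 : ℂ)
  have hS : ∀ ζ : ℂ, ζ ∈ S ↔ ζ ^ N = 1 := fun ζ => Polynomial.mem_nthRootsFinset hN 1
  let P : ℂ → Polynomial ℂ := fun t => ∏ ζ ∈ S, (Polynomial.X - Polynomial.C (φ (ζ * t)))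
  have hP : ∀ k, AnalyticAt ℂ (fun t => (P t).coeff k) 0 := fun k => by
    refine analyticAt_coeff_prod S (g := fun ζ t => φ (ζ * t)) (fun ζ _ => ?_) k
    exact AnalyticAt.fun_comp (f := fun t : ℂ => ζ * t) (by simpa using h.analyticAt) (by fun_prop)
  have hPinv : ∀ ω : ℂ, ω ^ N = 1 → ∀ t, P (ω * t) = P t := by
    intro ω hω t
    have hω0 : ω ≠ 0 := by rintro rfl; simp [hN.ne'] at hω
    refine Finset.prod_bij (fun ζ _ => ζ * ω) ?_ ?_ ?_ ?_
    · intro ζ hζ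
      rw [hS] at hζ ⊢
      rw [mul_pow, hζ, hω, one_mul]
    · intro a _ b _ hab
      exact mul_right_cancel₀ hω0 hab
    · intro b hb
      refine ⟨b / ω, ?_, div_mul_cancel₀ _ hω0⟩
      rw [hS] at hb ⊢
      rw [div_pow, hb, hω, div_one]
    · intro ζ _
      rw [mul_assoc]
  have hC := fun k => exists_eq_comp_pow hN (hP k) (fun ω hω t => by
    simp only [hPinv ω hω t])
  choose C hCan hC using hC
  have hdeg : ∀ t, (P t).natDegree < S.card + 1 := by
    intro t
    refine Nat.lt_succ_of_le ((Polynomial.natDegree_prod_le _ _).trans ?_)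
    refine (Finset.sum_le_card_nsmul _ _ 1 fun ζ _ => ?_).trans (by simp)
    exact (Polynomial.natDegree_X_sub_C _).le
  let Q : C2 → ℂ := fun z => ∑ k ∈ Finset.range (S.card + 1), C k (L.symm z).1 * (L.symm z).2 ^ k
  have hL1 : AnalyticAt ℂ (fun z : C2 => (L.symm z).1) 0 :=
    ((ContinuousLinearMap.fst ℂ ℂ ℂ).comp L.symm.toContinuousLinearMap).analyticAt _
  have hL2 : AnalyticAt ℂ (fun z : C2 => (L.symm z).2) 0 :=
    ((ContinuousLinearMap.snd ℂ ℂ ℂ).comp L.symm.toContinuousLinearMap).analyticAt _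
  have hQ : ∀ z t, t ^ N = (L.symm z).1 → Q z = ∏ ζ ∈ S, ((L.symm z).2 - φ (ζ * t)) := by
    intro z t ht
    simp only [Q, ← ht, hC]
    rw [← Polynomial.eval_eq_sum_range' (hdeg t)]
    simp [P, Polynomial.eval_prod]
  refine ⟨Q, ?_, Eventually.of_forall fun z => propext ?_⟩
  · refine Finset.analyticAt_fun_sum _ fun k _ => ?_
    refine AnalyticAt.fun_mul ?_ (hL2.fun_pow k)
    exact AnalyticAt.fun_comp (f := fun z : C2 => (L.symm z).1) (by simpa using hCan k) hL1
  · constructor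
    · rintro ⟨t, rfl⟩
      change Q _ = 0
      rw [hQ _ t (by simp [arc])]
      exact Finset.prod_eq_zero (i := 1) (by simp [hS]) (by simp [arc])
    · intro hz
      change Q z = 0 at hz
      obtain ⟨t, ht⟩ := IsAlgClosed.exists_pow_nat_eq (L.symm z).1 hN
      rw [hQ z t ht, Finset.prod_eq_zero_iff] at hz
      obtain ⟨ζ, hζ, hz⟩ := hz
      refine ⟨ζ * t, ?_⟩
      rw [arc, mul_pow, (hS ζ).1 hζ, one_mul, ht, ← sub_eq_zero.1 hz]
      simp

lemma isAnalyticGerm_of_zeros {Q : C2 → ℂ} (hQ : AnalyticAt ℂ Q 0) {Z : Set C2}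
    (hZ : Z =ᶠ[𝓝 0] {z | Q z = 0}) : IsAnalyticGerm Z :=
  ⟨1, fun _ => Q, fun _ => hQ, by simpa using hZ⟩

lemma isAnalyticGerm_inter_zeros {Q : C2 → ℂ} (hQ : AnalyticAt ℂ Q 0) {Z : Set C2}
    (hZ : IsAnalyticGerm Z) : IsAnalyticGerm (Z ∩ {z | Q z = 0}) := by
  obtain ⟨k, F, hF, hZF⟩ := hZ
  refine ⟨k + 1, Fin.cons Q F, fun i => ?_, ?_⟩
  · refine Fin.cases ?_ (fun j => ?_) i
    · simpa using hQ
    · simpa using hF j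
  · filter_upwards [hZF] with z hz
    apply propext
    change z ∈ Z ∧ Q z = 0 ↔ ∀ i, (Fin.cons Q F : Fin (k + 1) → C2 → ℂ) i z = 0
    rw [Fin.forall_fin_succ]
    have : z ∈ Z ↔ ∀ i, F i z = 0 := iff_of_eq hz
    simp [this, and_comm]

/-! ### Irreducibility of branches and the components of a curve -/

/-- An analytic germ contains a branch or meets it at most at the origin. -/
lemma analyticGerm_dichotomy (h : IsPuiseux N φ) {W : Set C2} (hW : IsAnalyticGerm W) :
    branch L N φ ≤ᶠ[𝓝 0] W ∨ ∀ᶠ t in 𝓝[≠] (0 : ℂ), arc L N φ t ∉ W := by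
  obtain ⟨k, F, hF, hWF⟩ := hW
  have hWF' := (tendsto_arc (L := L) h).eventually hWF
  have hFa : ∀ i, AnalyticAt ℂ (fun t => F i (arc L N φ t)) 0 := fun i =>
    AnalyticAt.fun_comp (by simpa [arc_zero h] using hF i) (analyticAt_arc h)
  by_cases hall : ∀ i, ∀ᶠ t in 𝓝 (0 : ℂ), F i (arc L N φ t) = 0
  · left
    rw [branch_le_iff h]
    filter_upwards [eventually_all.2 hall, hWF'] with t h1 h2
    exact (iff_of_eq h2).2 h1
  · right
    obtain ⟨i, hi⟩ := not_forall.1 hall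
    rcases (hFa i).eventually_eq_zero_or_eventually_ne_zero with h1 | h1
    · exact absurd h1 hi
    · filter_upwards [h1, hWF'.filter_mono nhdsWithin_le_nhds] with t h2 h3 h4
      exact h2 ((iff_of_eq h3).1 h4 i)

/-- If a branch is the union of two analytic germs, one of them contains points of the branch other
than the origin arbitrarily close to it, hence contains the branch. -/
lemma isIrreducibleGerm_branch (h : IsPuiseux N φ) : IsIrreducibleGerm (branch L N φ) := by
  obtain ⟨Q, hQ, hQe⟩ := exists_branch_eq (L := L) h
  refine ⟨isAnalyticGerm_of_zeros hQ hQe, ?_, ?_⟩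
  · intro he
    have := (iff_of_eq he.self_of_nhds).1 (⟨0, arc_zero h⟩ : (0 : C2) ∈ branch L N φ)
    exact this
  · intro X₁ X₂ h1 h2 he
    have hsub : ∀ᶠ t in 𝓝 (0 : ℂ), arc L N φ t ∈ X₁ ∪ X₂ := (branch_le_iff h).1 he.le
    rcases analyticGerm_dichotomy (L := L) h h1 with h1' | h1'
    · left
      refine h1'.antisymm ?_
      filter_upwards [he] with z hz hz1
      exact (iff_of_eq hz).2 (Or.inl hz1)
    · rcases analyticGerm_dichotomy (L := L) h h2 with h2' | h2'
      · right
        refine h2'.antisymm ?_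
        filter_upwards [he] with z hz hz1
        exact (iff_of_eq hz).2 (Or.inr hz1)
      · obtain ⟨t, ht1, ht2, ht3⟩ :=
          (h1'.and (h2'.and (hsub.filter_mono nhdsWithin_le_nhds))).exists
        exact (ht3.elim ht1 ht2).elim

/-- An irreducible germ in the zero set of a product lies in the zero set of a factor. -/
lemma IsIrreducibleGerm.le_zeros_of_mul {Z : Set C2} (hZ : IsIrreducibleGerm Z) {Q₁ Q₂ : C2 → ℂ}
    (h1 : AnalyticAt ℂ Q₁ 0) (h2 : AnalyticAt ℂ Q₂ 0)
    (h : Z ≤ᶠ[𝓝 0] {z | Q₁ z * Q₂ z = 0}) :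
    Z ≤ᶠ[𝓝 0] {z | Q₁ z = 0} ∨ Z ≤ᶠ[𝓝 0] {z | Q₂ z = 0} := by
  have he : Z =ᶠ[𝓝 0] (Z ∩ {z | Q₁ z = 0} ∪ Z ∩ {z | Q₂ z = 0} : Set C2) := by
    filter_upwards [h] with z hz
    apply propext
    constructor
    · intro hzZ
      rcases mul_eq_zero.1 (hz hzZ) with h3 | h3
      · exact Or.inl ⟨hzZ, h3⟩
      · exact Or.inr ⟨hzZ, h3⟩
    · rintro (⟨h3, _⟩ | ⟨h3, _⟩) <;> exact h3
  refine (hZ.2.2 _ _ (isAnalyticGerm_inter_zeros h1 hZ.1)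
    (isAnalyticGerm_inter_zeros h2 hZ.1) he).imp (fun h3 => ?_) fun h3 => ?_
  all_goals
    filter_upwards [h3] with z hz hzZ
    exact ((iff_of_eq hz).1 hzZ).2

lemma IsIrreducibleGerm.le_branch_of_le {Z : Set C2} (hZ : IsIrreducibleGerm Z)
    {l : List (ℂ → ℂ)} (hl : ∀ φ ∈ l, IsPuiseux N φ)
    (h : Z ≤ᶠ[𝓝 0] {z | ∃ φ ∈ l, z ∈ branch L N φ}) :
    ∃ φ ∈ l, Z ≤ᶠ[𝓝 0] branch L N φ := by
  -- one factor at a time is split off the product of the equations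
  have key : ∀ l : List (ℂ → ℂ), (∀ φ ∈ l, IsPuiseux N φ) →
      ∃ Q : C2 → ℂ, AnalyticAt ℂ Q 0 ∧
        {z | ∃ φ ∈ l, z ∈ branch L N φ} =ᶠ[𝓝 0] {z | Q z = 0} ∧
        (Z ≤ᶠ[𝓝 0] {z | Q z = 0} → ∃ φ ∈ l, Z ≤ᶠ[𝓝 0] branch L N φ) := by
    intro l
    induction l with
    | nil =>
      intro _
      refine ⟨fun _ => 1, analyticAt_const,
        by simpa using! EventuallyEq.refl (𝓝 (0 : C2)) (∅ : Set C2), fun h1 => absurd ?_ hZ.2.1⟩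
      filter_upwards [h1] with z hz
      refine propext ⟨fun h2 => ?_, fun h2 => h2.elim⟩
      exact one_ne_zero (α := ℂ) (hz h2)
    | cons φ l ih =>
      intro hl
      obtain ⟨Q, hQ, hQe, hQZ⟩ := ih fun χ hχ => hl χ (List.mem_cons_of_mem _ hχ)
      obtain ⟨R, hR, hRe⟩ := exists_branch_eq (L := L) (hl φ List.mem_cons_self)
      refine ⟨fun z => R z * Q z, hR.fun_mul hQ, ?_, fun h1 => ?_⟩
      · filter_upwards [hQe, hRe] with z h1 h2
        apply propext
        have h1' : (∃ φ ∈ l, z ∈ branch L N φ) ↔ Q z = 0 := iff_of_eq h1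
        have h2' : z ∈ branch L N φ ↔ R z = 0 := iff_of_eq h2
        change (∃ χ ∈ φ :: l, z ∈ branch L N χ) ↔ R z * Q z = 0
        simp [h1', h2']
      · rcases IsIrreducibleGerm.le_zeros_of_mul hZ hR hQ h1 with h2 | h2
        · exact ⟨φ, List.mem_cons_self, h2.trans hRe.symm.le⟩
        · obtain ⟨χ, hχ, h3⟩ := hQZ h2
          exact ⟨χ, List.mem_cons_of_mem _ hχ, h3⟩
  obtain ⟨Q, _, hQe, hQZ⟩ := key l hl
  exact hQZ (h.trans hQe.le)

/-- Two branches with the same `x = t ^ N` coincide as soon as `φ t` and `χ (ζ t)` coincide for some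
`N`-th root of unity `ζ`. -/
lemma branch_eq_or_ne (h₁ : IsPuiseux N φ) (h₂ : IsPuiseux N χ) :
    branch L N φ =ᶠ[𝓝 0] branch L N χ ∨
      ∀ ζ : ℂ, ζ ^ N = 1 → ¬ ∀ᶠ t in 𝓝 (0 : ℂ), φ t - χ (ζ * t) = 0 := by
  by_cases hex : ∃ ζ : ℂ, ζ ^ N = 1 ∧ ∀ᶠ t in 𝓝 (0 : ℂ), φ t - χ (ζ * t) = 0
  · left
    obtain ⟨ζ, hζ, hφχ⟩ := hex
    have hζ0 : ζ ≠ 0 := by rintro rfl; simp [h₁.pos.ne'] at hζ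
    refine EventuallyLE.antisymm ?_ ?_
    · rw [branch_le_iff h₁]
      filter_upwards [hφχ] with t ht
      exact ⟨ζ * t, by rw [arc, arc, mul_pow, hζ, one_mul, sub_eq_zero.1 ht]⟩
    · rw [branch_le_iff h₂]
      have h3 : Tendsto (fun t : ℂ => ζ⁻¹ * t) (𝓝 0) (𝓝 0) := by
        have := (continuous_const_mul ζ⁻¹).tendsto (0 : ℂ)
        rwa [mul_zero] at this
      filter_upwards [h3.eventually hφχ] with t ht
      refine ⟨ζ⁻¹ * t, ?_⟩
      rw [mul_inv_cancel_left₀ hζ0] at ht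
      rw [arc, arc, mul_pow, inv_pow, hζ, inv_one, one_mul, sub_eq_zero.1 ht]
  · right
    exact fun ζ hζ h => hex ⟨ζ, hζ, h⟩

/-- An inclusion of branches with the same `x = t ^ N` is an equality. -/
lemma branch_eq_of_le (h₁ : IsPuiseux N φ) (h₂ : IsPuiseux N χ)
    (h : branch L N φ ≤ᶠ[𝓝 0] branch L N χ) : branch L N φ =ᶠ[𝓝 0] branch L N χ := by
  refine (branch_eq_or_ne h₁ h₂).resolve_right fun hne => ?_
  rw [branch_le_iff h₁] at h
  have hfin : ∀ᶠ t in 𝓝[≠] (0 : ℂ), ∀ ζ ∈ Polynomial.nthRootsFinset N (1 : ℂ),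
      φ t - χ (ζ * t) ≠ 0 := by
    rw [Filter.eventually_all_finset]
    intro ζ hζ
    have h3 : AnalyticAt ℂ (fun t => φ t - χ (ζ * t)) 0 := h₁.analyticAt.fun_sub
      (AnalyticAt.fun_comp (f := fun t : ℂ => ζ * t) (by simpa using h₂.analyticAt) (by fun_prop))
    exact h3.eventually_eq_zero_or_eventually_ne_zero.resolve_left
      (hne ζ ((Polynomial.mem_nthRootsFinset h₁.pos 1).1 hζ))
  obtain ⟨t, ⟨s, hs⟩, ht1, ht2⟩ :=
    ((h.filter_mono nhdsWithin_le_nhds).and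
      (hfin.and (self_mem_nhdsWithin (s := {0}ᶜ)))).exists
  have ht0 : t ≠ 0 := ht2
  have hst := L.injective hs
  simp only [Prod.mk.injEq] at hst
  have := ht1 (s / t) ((Polynomial.mem_nthRootsFinset h₁.pos 1).2
    (by rw [div_pow, hst.1, div_self (pow_ne_zero _ ht0)]))
  rw [div_mul_cancel₀ _ ht0, hst.2, sub_self] at this
  exact this rfl

/-- The irreducible components of a curve germ are its branches. -/
lemma isIrreducibleComponentGerm_iff {X : Set C2} {l : List (ℂ → ℂ)}
    (hl : ∀ φ ∈ l, IsPuiseux N φ)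
    (hX : X =ᶠ[𝓝 (0 : C2)] {z | ∃ φ ∈ l, z ∈ branch L N φ}) {Z : Set C2} :
    IsIrreducibleComponentGerm Z X ↔ ∃ φ ∈ l, Z =ᶠ[𝓝 0] branch L N φ := by
  have hle : ∀ φ ∈ l, branch L N φ ≤ᶠ[𝓝 0] X := by
    intro φ hφ
    filter_upwards [hX] with z hz h1
    exact (iff_of_eq hz).2 ⟨φ, hφ, h1⟩
  constructor
  · rintro ⟨hZ, hZX, hmax⟩
    obtain ⟨φ, hφ, h1⟩ := IsIrreducibleGerm.le_branch_of_le hZ hl (hZX.trans hX.le)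
    exact ⟨φ, hφ, (hmax _ (isIrreducibleGerm_branch (hl φ hφ)) h1 (hle φ hφ)).symm⟩
  · rintro ⟨φ, hφ, hZ⟩
    refine ⟨?_, hZ.le.trans (hle φ hφ), ?_⟩
    · obtain ⟨⟨k, F, hF, hbF⟩, h2, h3⟩ := isIrreducibleGerm_branch (L := L) (hl φ hφ)
      exact ⟨⟨k, F, hF, hZ.trans hbF⟩, fun h4 => h2 (hZ.symm.trans h4), fun X₁ X₂ h4 h5 h6 =>
        (h3 X₁ X₂ h4 h5 (hZ.symm.trans h6)).imp hZ.trans hZ.trans⟩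
    · intro W hW hZW hWX
      obtain ⟨χ, hχ, h1⟩ := IsIrreducibleGerm.le_branch_of_le hW hl (hWX.trans hX.le)
      have h2 := branch_eq_of_le (hl φ hφ) (hl χ hχ) ((hZ.symm.le.trans hZW).trans h1)
      exact (h1.trans (h2.symm.trans hZ.symm).le).antisymm hZW

/-! ### Transport of branches by a bi-Hölder homeomorphism -/

/-- A punctured disk is the image of a half-plane under the exponential function. -/
lemma isPreconnected_punctured_ball {ρ : ℝ} (hρ : 0 < ρ) :
    IsPreconnected (Metric.ball (0 : ℂ) ρ \ {0}) := by
  have h1 : IsPreconnected {z : ℂ | z.re < Real.log ρ} :=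
    (convex_halfSpace_re_lt (Real.log ρ)).isPreconnected
  have h2 : Metric.ball (0 : ℂ) ρ \ {0} = Complex.exp '' {z : ℂ | z.re < Real.log ρ} := by
    ext w
    simp only [Set.mem_sdiff, Metric.mem_ball, dist_zero_right, Set.mem_singleton_iff,
      Set.mem_image, Set.mem_ofPred_eq]
    constructor
    · rintro ⟨hw, hw0⟩
      refine ⟨Complex.log w, ?_, Complex.exp_log hw0⟩
      rw [Complex.log_re]
      exact Real.log_lt_log (norm_pos_iff.2 hw0) hw
    · rintro ⟨z, hz, rfl⟩
      refine ⟨?_, Complex.exp_ne_zero z⟩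
      rw [Complex.norm_exp]
      exact (Real.lt_log_iff_exp_lt hρ).1 hz
  rw [h2]
  exact h1.image _ Complex.continuous_exp.continuousOn

variable {α : NNReal} {X Y : Set C2} {h : PartialEquiv C2 C2}

lemma biHolder_symm (hh : IsBiHolderGermHomeo α X Y h) : IsBiHolderGermHomeo α Y X h.symm where
  source_eq := hh.target_eq
  target_eq := hh.source_eq
  zero_mem := by
    have := h.map_source hh.zero_mem
    rwa [hh.map_zero] at this
  map_zero := by
    have := h.left_inv hh.zero_mem
    rwa [hh.map_zero] at this
  holder := hh.holder_symm
  holder_symm := hh.holder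

lemma continuousOn_biHolder (hα : 0 < α) (hh : IsBiHolderGermHomeo α X Y h) :
    ContinuousOn h h.source := by
  obtain ⟨K, hK⟩ := hh.holder
  exact hK.continuousOn hα

lemma tendsto_biHolder (hα : 0 < α) (hh : IsBiHolderGermHomeo α X Y h) :
    Tendsto h (𝓝[h.source] 0) (𝓝 0) := by
  have := continuousOn_biHolder hα hh 0 hh.zero_mem
  rwa [ContinuousWithinAt, hh.map_zero] at this

/-- A point of an image germ that is close to `0` comes from a point close to `0`. -/
lemma eventually_germImage (hα : 0 < α) (hh : IsBiHolderGermHomeo α X Y h) {P : C2 → Prop}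
    (hP : ∀ᶠ z in 𝓝 (0 : C2), P z) :
    ∀ᶠ w in 𝓝 (0 : C2), ∀ z ∈ h.source, h z = w → P z := by
  have h1 := (tendsto_biHolder hα (biHolder_symm hh)).eventually hP
  rw [eventually_nhdsWithin_iff] at h1
  filter_upwards [h1] with w hw z hz hzw
  have := hw (by rw [← hzw]; exact h.map_source hz)
  rwa [← hzw, h.left_inv hz] at this

lemma germImage_mono (hα : 0 < α) (hh : IsBiHolderGermHomeo α X Y h) {Z Z' : Set C2}
    (hZ : Z ≤ᶠ[𝓝 0] Z') : germImage h Z ≤ᶠ[𝓝 0] germImage h Z' := by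
  filter_upwards [eventually_germImage hα hh hZ] with w hw
  rintro ⟨z, ⟨hz1, hz2⟩, rfl⟩
  exact ⟨z, ⟨hz1, hw z hz1 rfl hz2⟩, rfl⟩

lemma germImage_congr (hα : 0 < α) (hh : IsBiHolderGermHomeo α X Y h) {Z Z' : Set C2}
    (hZ : Z =ᶠ[𝓝 0] Z') : germImage h Z =ᶠ[𝓝 0] germImage h Z' :=
  (germImage_mono hα hh hZ.le).antisymm (germImage_mono hα hh hZ.symm.le)

lemma germImage_symm_germImage (Z : Set C2) :
    germImage h.symm (germImage h Z) = h.source ∩ Z := by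
  ext z
  constructor
  · rintro ⟨_, ⟨-, w, ⟨hw1, hw2⟩, rfl⟩, rfl⟩
    rw [h.left_inv hw1]
    exact ⟨hw1, hw2⟩
  · rintro ⟨hz1, hz2⟩
    exact ⟨h z, ⟨h.map_source hz1, z, ⟨hz1, hz2⟩, rfl⟩, h.left_inv hz1⟩

lemma germImage_symm_germImage_eq (hh : IsBiHolderGermHomeo α X Y h) {Z : Set C2}
    (hZ : Z ≤ᶠ[𝓝 0] X) : germImage h.symm (germImage h Z) =ᶠ[𝓝 0] Z := by
  rw [germImage_symm_germImage]
  filter_upwards [hZ, hh.source_eq] with z h1 h2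
  refine propext ⟨fun h3 => h3.2, fun h3 => ⟨(iff_of_eq h2).2 (h1 h3), h3⟩⟩

lemma eventually_branch_inter {L : (ℂ × ℂ) ≃L[ℂ] C2} {N : ℕ} {φ χ : ℂ → ℂ} (h₁ : IsPuiseux N φ)
    (h₂ : IsPuiseux N χ) (hne : ¬ branch L N φ =ᶠ[𝓝 0] branch L N χ) :
    ∀ᶠ z in 𝓝 (0 : C2), z ∈ branch L N φ → z ∈ branch L N χ → z = 0 := by
  have h1 := (analyticGerm_dichotomy (L := L) h₁ (isIrreducibleGerm_branch h₂).1).resolve_left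
    fun hle => hne (branch_eq_of_le h₁ h₂ hle)
  rw [eventually_nhdsWithin_iff] at h1
  filter_upwards [eventually_forall_arc_eq (L := L) (N := N) (φ := φ) h1] with z hz
  rintro ⟨t, rfl⟩ hχ
  by_contra hz0
  refine hz t rfl ?_ hχ
  rintro rfl
  exact hz0 (arc_zero h₁)

/-- Near the origin, a branch is closed. -/
lemma eventually_isClosed_branch_inter {L : (ℂ × ℂ) ≃L[ℂ] C2} {N : ℕ} {φ : ℂ → ℂ}
    (hφ : IsPuiseux N φ) :
    ∀ᶠ ε in 𝓝[>] (0 : ℝ), IsClosed (branch L N φ ∩ Metric.closedBall 0 ε) := by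
  obtain ⟨Q, hQ, hbQ⟩ := exists_branch_eq (L := L) hφ
  obtain ⟨δ, hδ, hball⟩ := Metric.eventually_nhds_iff_ball.1 (hQ.eventually_analyticAt.and hbQ)
  filter_upwards [Ioo_mem_nhdsGT hδ] with ε hε
  have hsub : Metric.closedBall (0 : C2) ε ⊆ Metric.ball 0 δ := Metric.closedBall_subset_ball hε.2
  have he : branch L N φ ∩ Metric.closedBall 0 ε = Metric.closedBall 0 ε ∩ Q ⁻¹' {0} := by
    ext z
    constructor
    · rintro ⟨h1, h2⟩
      exact ⟨h2, (iff_of_eq (hball z (hsub h2)).2).1 h1⟩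
    · rintro ⟨h1, h2⟩
      exact ⟨(iff_of_eq (hball z (hsub h1)).2).2 h2, h1⟩
  rw [he]
  refine ContinuousOn.preimage_isClosed_of_isClosed (fun z hz => ?_) Metric.isClosed_closedBall
    isClosed_singleton
  exact (hball z (hsub hz)).1.continuousAt.continuousWithinAt

lemma eventually_forall_mem_closedBall {P : C2 → Prop} (hP : ∀ᶠ z in 𝓝 (0 : C2), P z) :
    ∀ᶠ ε in 𝓝[>] (0 : ℝ), ∀ z ∈ Metric.closedBall (0 : C2) ε, P z := by
  obtain ⟨δ, hδ, hball⟩ := Metric.eventually_nhds_iff_ball.1 hP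
  filter_upwards [Ioo_mem_nhdsGT hδ] with ε hε z hz
  exact hball z (Metric.closedBall_subset_ball hε.2 hz)

/-- The image of a branch lies in a single branch, because a branch without the origin is connected
and the other curve without the origin is the disjoint union of its branches. -/
lemma exists_germImage_branch_le (hα : 0 < α) (hh : IsBiHolderGermHomeo α X Y h)
    {L : (ℂ × ℂ) ≃L[ℂ] C2} {N : ℕ} {φ : ℂ → ℂ} (hφ : IsPuiseux N φ)
    (hφX : branch L N φ ≤ᶠ[𝓝 0] X)
    {L' : (ℂ × ℂ) ≃L[ℂ] C2} {N' : ℕ} {l' : List (ℂ → ℂ)} (hl' : ∀ χ ∈ l', IsPuiseux N' χ)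
    (hY : Y =ᶠ[𝓝 (0 : C2)] {z | ∃ χ ∈ l', z ∈ branch L' N' χ}) :
    ∃ χ ∈ l', germImage h (branch L N φ) ≤ᶠ[𝓝 0] branch L' N' χ := by
  have hl'fin : {χ | χ ∈ l'}.Finite := List.finite_toSet l'
  -- a closed ball on which the germs of the branches of the target are represented faithfully
  obtain ⟨ε, hε, hclosed, heq, hinter, hmem⟩ : ∃ ε : ℝ, 0 < ε ∧
      (∀ χ ∈ l', IsClosed (branch L' N' χ ∩ Metric.closedBall 0 ε)) ∧
      (∀ χ ∈ l', ∀ ψ ∈ l', branch L' N' χ =ᶠ[𝓝 0] branch L' N' ψ →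
        ∀ z ∈ Metric.closedBall (0 : C2) ε, z ∈ branch L' N' ψ → z ∈ branch L' N' χ) ∧
      (∀ χ ∈ l', ∀ ψ ∈ l', ¬ branch L' N' χ =ᶠ[𝓝 0] branch L' N' ψ →
        ∀ z ∈ Metric.closedBall (0 : C2) ε, z ∈ branch L' N' χ → z ∈ branch L' N' ψ → z = 0) ∧
      ∀ z ∈ Metric.closedBall (0 : C2) ε, z ∈ h.target → ∃ χ ∈ l', z ∈ branch L' N' χ := by
    have h1 : ∀ᶠ ε in 𝓝[>] (0 : ℝ), ∀ χ ∈ {χ | χ ∈ l'},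
        IsClosed (branch L' N' χ ∩ Metric.closedBall 0 ε) :=
      (Filter.eventually_all_finite hl'fin).2 fun χ hχ =>
        eventually_isClosed_branch_inter (hl' χ hχ)
    have h2' : ∀ᶠ ε in 𝓝[>] (0 : ℝ), ∀ χ ∈ {χ | χ ∈ l'}, ∀ ψ ∈ {χ | χ ∈ l'},
        branch L' N' χ =ᶠ[𝓝 0] branch L' N' ψ →
        ∀ z ∈ Metric.closedBall (0 : C2) ε, z ∈ branch L' N' ψ → z ∈ branch L' N' χ := by
      refine (Filter.eventually_all_finite hl'fin).2 fun χ hχ =>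
        (Filter.eventually_all_finite hl'fin).2 fun ψ hψ => ?_
      rw [Filter.eventually_imp_distrib_left]
      exact fun he => eventually_forall_mem_closedBall he.symm.le
    have h2 : ∀ᶠ ε in 𝓝[>] (0 : ℝ), ∀ χ ∈ {χ | χ ∈ l'}, ∀ ψ ∈ {χ | χ ∈ l'},
        ¬ branch L' N' χ =ᶠ[𝓝 0] branch L' N' ψ →
        ∀ z ∈ Metric.closedBall (0 : C2) ε, z ∈ branch L' N' χ → z ∈ branch L' N' ψ → z = 0 := by
      refine (Filter.eventually_all_finite hl'fin).2 fun χ hχ =>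
        (Filter.eventually_all_finite hl'fin).2 fun ψ hψ => ?_
      rw [Filter.eventually_imp_distrib_left]
      exact fun hne => eventually_forall_mem_closedBall
        (eventually_branch_inter (hl' χ hχ) (hl' ψ hψ) hne)
    have h3 : ∀ᶠ z in 𝓝 (0 : C2), z ∈ h.target → ∃ χ ∈ l', z ∈ branch L' N' χ :=
      (hh.target_eq.trans hY).le
    obtain ⟨ε, h4, h5', h5, h6, h7⟩ := (h1.and (h2'.and (h2.and
      ((eventually_forall_mem_closedBall h3).and self_mem_nhdsWithin)))).exists
    exact ⟨ε, h7, h4, h5', h5, h6⟩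
  -- a disk of parameters that is mapped to this ball
  have hsource : ∀ᶠ t in 𝓝 (0 : ℂ), arc L N φ t ∈ h.source :=
    (branch_le_iff hφ).1 (hφX.trans hh.source_eq.symm.le)
  have hlim : Tendsto (fun t => h (arc L N φ t)) (𝓝 0) (𝓝 0) :=
    (tendsto_biHolder hα hh).comp (tendsto_nhdsWithin_iff.2 ⟨tendsto_arc hφ, hsource⟩)
  obtain ⟨ρ, hρ, hball⟩ := Metric.eventually_nhds_iff_ball.1 (hsource.and
    (hφ.analyticAt.eventually_analyticAt.and
      (hlim.eventually (Metric.closedBall_mem_nhds (0 : C2) hε))))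
  let S : Set ℂ := Metric.ball 0 ρ \ {0}
  let g : ℂ → C2 := fun t => h (arc L N φ t)
  have hgS : IsPreconnected (g '' S) := by
    refine (isPreconnected_punctured_ball hρ).image g ?_
    refine (continuousOn_biHolder hα hh).comp (fun t ht => ?_) fun t ht => (hball t ht.1).1
    exact (continuousAt_arc (hball t ht.1).2.1.continuousAt).continuousWithinAt
  have hg0 : ∀ t ∈ S, g t ≠ 0 := by
    intro t ht h0
    refine arc_ne_zero (L := L) hφ (fun h => ht.2 h : t ≠ 0) ?_
    exact h.injOn (hball t ht.1).1 hh.zero_mem (h0.trans hh.map_zero.symm)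
  have hgY : ∀ t ∈ S, ∃ χ ∈ l', g t ∈ branch L' N' χ := fun t ht =>
    hmem _ (hball t ht.1).2.2 (h.map_source (hball t ht.1).1)
  have ht₀ : ((ρ / 2 : ℝ) : ℂ) ∈ S := by
    refine ⟨?_, ?_⟩
    · rw [Metric.mem_ball, dist_zero_right, Complex.norm_real, Real.norm_eq_abs,
        abs_of_pos (half_pos hρ)]
      exact half_lt_self hρ
    · simpa using hρ.ne'
  obtain ⟨χ, hχ, hgχ⟩ := hgY _ ht₀
  refine ⟨χ, hχ, ?_⟩
  let T : Set C2 := branch L' N' χ ∩ Metric.closedBall 0 ε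
  let T' : Set C2 := ⋃ ψ ∈ {ψ | ψ ∈ l' ∧ ¬ branch L' N' χ =ᶠ[𝓝 0] branch L' N' ψ},
    branch L' N' ψ ∩ Metric.closedBall 0 ε
  have hT' : IsClosed T' :=
    (hl'fin.subset fun ψ hψ => hψ.1).isClosed_biUnion fun ψ hψ => hclosed ψ hψ.1
  have hTT' : ∀ t ∈ S, g t ∈ T → g t ∉ T' := by
    intro t ht h1 h2
    obtain ⟨ψ, hψ, h3⟩ := Set.mem_iUnion₂.1 h2
    exact hg0 t ht (hinter χ hχ ψ hψ.1 hψ.2 _ h1.2 h1.1 h3.1)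
  have hcover : g '' S ⊆ T ∪ T' := by
    rintro _ ⟨t, ht, rfl⟩
    obtain ⟨ψ, hψ, h1⟩ := hgY t ht
    by_cases he : branch L' N' χ =ᶠ[𝓝 0] branch L' N' ψ
    · exact Or.inl ⟨heq χ hχ ψ hψ he _ (hball t ht.1).2.2 h1, (hball t ht.1).2.2⟩
    · exact Or.inr (Set.mem_biUnion (show ψ ∈ _ from ⟨hψ, he⟩) ⟨h1, (hball t ht.1).2.2⟩)
  have hgT : ∀ t ∈ S, g t ∈ T := by
    intro t ht
    refine (hcover ⟨t, ht, rfl⟩).resolve_right fun h1 => ?_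
    obtain ⟨_, ⟨s, hs, rfl⟩, h2, h3⟩ := isPreconnected_closed_iff.1 hgS T T' (hclosed χ hχ) hT'
      hcover ⟨_, ⟨_, ht₀, rfl⟩, hgχ, (hball _ ht₀.1).2.2⟩ ⟨_, ⟨t, ht, rfl⟩, h1⟩
    exact hTT' s hs h2 h3
  have harc : ∀ᶠ z in 𝓝 (0 : C2), ∀ t, arc L N φ t = z → t ∈ Metric.ball (0 : ℂ) ρ :=
    eventually_forall_arc_eq (Metric.ball_mem_nhds _ hρ)
  filter_upwards [eventually_germImage hα hh harc] with w hw
  rintro ⟨z, ⟨hz, t, rfl⟩, rfl⟩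
  have ht := hw _ hz rfl t rfl
  by_cases ht0 : t = 0
  · subst ht0
    rw [arc_zero hφ, hh.map_zero]
    exact ⟨0, arc_zero (hl' χ hχ)⟩
  · exact (hgT t ⟨ht, ht0⟩).1

/-- A bi-Hölder homeomorphism maps components to components. -/
lemma isIrreducibleComponentGerm_germImage (hα : 0 < α) (hX : IsPlaneCurveGerm X)
    (hY : IsPlaneCurveGerm Y) (hh : IsBiHolderGermHomeo α X Y h) {Z : Set C2}
    (hZ : IsIrreducibleComponentGerm Z X) : IsIrreducibleComponentGerm (germImage h Z) Y := by
  obtain ⟨L, N, l, hl, hXl⟩ := exists_branches hX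
  obtain ⟨L', N', l', hl', hYl'⟩ := exists_branches hY
  have hX' : ∀ φ ∈ l, branch L N φ ≤ᶠ[𝓝 0] X := fun φ hφ =>
    ((isIrreducibleComponentGerm_iff hl hXl).2 ⟨φ, hφ, EventuallyEq.rfl⟩).2.1
  have hY' : ∀ χ ∈ l', branch L' N' χ ≤ᶠ[𝓝 0] Y := fun χ hχ =>
    ((isIrreducibleComponentGerm_iff hl' hYl').2 ⟨χ, hχ, EventuallyEq.rfl⟩).2.1
  obtain ⟨φ, hφ, hZφ⟩ := (isIrreducibleComponentGerm_iff hl hXl).1 hZ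
  refine (isIrreducibleComponentGerm_iff hl' hYl').2 ?_
  have hh' := biHolder_symm hh
  -- `h` maps `φ` into `χ`, its inverse maps `χ` into some `ψ`, and then `φ` lies in `ψ`
  obtain ⟨χ, hχ, h1⟩ := exists_germImage_branch_le hα hh (hl φ hφ) (hX' φ hφ) hl' hYl'
  obtain ⟨ψ, hψ, h2⟩ := exists_germImage_branch_le hα hh' (hl' χ hχ) (hY' χ hχ) hl hXl
  have h3 := germImage_symm_germImage_eq hh (hX' φ hφ)
  have h4 : branch L N φ =ᶠ[𝓝 0] branch L N ψ := branch_eq_of_le (hl φ hφ) (hl ψ hψ)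
    (h3.symm.le.trans ((germImage_mono hα hh' h1).trans h2))
  have h5 := germImage_symm_germImage_eq hh' (hY' χ hχ)
  rw [PartialEquiv.symm_symm] at h5
  exact ⟨χ, hχ, (germImage_congr hα hh hZφ).trans
    (h1.antisymm (h5.symm.le.trans (germImage_mono hα hh (h2.trans h4.symm.le))))⟩

lemma areIrreducibleComponents_germImage (hα : 0 < α) (hX : IsPlaneCurveGerm X)
    (hY : IsPlaneCurveGerm Y) (hh : IsBiHolderGermHomeo α X Y h) {r : ℕ} {C : Fin r → Set C2}
    (hC : AreIrreducibleComponents C X) :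
    AreIrreducibleComponents (fun i => germImage h (C i)) Y := by
  have hh' := biHolder_symm hh
  refine ⟨fun i => isIrreducibleComponentGerm_germImage hα hX hY hh (hC.1 i), ?_, ?_⟩
  · intro Z hZ
    obtain ⟨i, hi⟩ := hC.2.1 _ (isIrreducibleComponentGerm_germImage hα hY hX hh' hZ)
    have h1 := germImage_symm_germImage_eq hh' hZ.2.1
    rw [PartialEquiv.symm_symm] at h1
    exact ⟨i, h1.symm.trans (germImage_congr hα hh hi)⟩
  · intro i j hij
    refine hC.2.2 i j ?_
    exact (germImage_symm_germImage_eq hh (hC.1 i).2.1).symm.trans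
      ((germImage_congr hα hh' hij).trans (germImage_symm_germImage_eq hh (hC.1 j).2.1))

/-! ### Contact of branches -/

/-- A strong form of `HasContact Γ₁ Γ₂ q`: the function `f_{Γ₁,Γ₂} (r)` is comparable to `r ^ q`. -/
def HasPowerContact (Γ₁ Γ₂ : Set C2) (q : ℝ) : Prop :=
  ∀ᶠ ε in 𝓝[>] (0 : ℝ), ∃ A B : ℝ, 0 < A ∧ 0 < B ∧ ∀ᶠ r in 𝓝[>] (0 : ℝ),
    A * r ^ q ≤ contactDist (Γ₁ ∩ Metric.closedBall 0 ε) (Γ₂ ∩ Metric.closedBall 0 ε) r ∧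
    contactDist (Γ₁ ∩ Metric.closedBall 0 ε) (Γ₂ ∩ Metric.closedBall 0 ε) r ≤ B * r ^ q

lemma HasPowerContact.hasContact {Γ₁ Γ₂ : Set C2} {q : ℝ} (h : HasPowerContact Γ₁ Γ₂ q) :
    HasContact Γ₁ Γ₂ q := by
  filter_upwards [h] with ε hε
  obtain ⟨A, B, hA, hB, hAB⟩ := hε
  have hlog : Tendsto Real.log (𝓝[>] 0) atBot := Real.tendsto_log_nhdsGT_zero
  have hlim : ∀ c : ℝ, Tendsto (fun r : ℝ => q + c / Real.log r) (𝓝[>] 0) (𝓝 q) := by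
    intro c
    have h1 : Tendsto (fun r : ℝ => c / Real.log r) (𝓝[>] 0) (𝓝 0) :=
      hlog.const_div_atBot c
    simpa using h1.const_add q
  refine tendsto_of_tendsto_of_tendsto_of_le_of_le' (hlim (Real.log B)) (hlim (Real.log A)) ?_ ?_
  all_goals
    filter_upwards [hAB, hlog.eventually (eventually_lt_atBot 0), self_mem_nhdsWithin]
      with r hr hr1 hr0
    have hr0' : (0 : ℝ) < r := hr0
    have hpow : 0 < r ^ q := Real.rpow_pos_of_pos hr0' q
    have hlow : 0 < A * r ^ q := mul_pos hA hpow
    have h1 := Real.log_le_log hlow hr.1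
    have h2 := Real.log_le_log (hlow.trans_le hr.1) hr.2
    rw [Real.log_mul (by positivity) hpow.ne', Real.log_rpow hr0'] at h1 h2
    have hne : Real.log r ≠ 0 := hr1.ne
    have e : ∀ c, q + c / Real.log r = (c + q * Real.log r) / Real.log r := by
      intro c; field_simp; ring
    rw [e]
    exact div_le_div_of_nonpos_of_le hr1.le (by assumption)

lemma HasPowerContact.congr {Γ₁ Γ₂ Δ₁ Δ₂ : Set C2} {q : ℝ} (h : HasPowerContact Γ₁ Γ₂ q)
    (h1 : Γ₁ =ᶠ[𝓝 0] Δ₁) (h2 : Γ₂ =ᶠ[𝓝 0] Δ₂) : HasPowerContact Δ₁ Δ₂ q := by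
  filter_upwards [h, eventually_forall_mem_closedBall h1, eventually_forall_mem_closedBall h2]
    with ε hε h3 h4
  have e1 : Γ₁ ∩ Metric.closedBall 0 ε = Δ₁ ∩ Metric.closedBall 0 ε := by
    ext z
    exact and_congr_left fun hz => iff_of_eq (h3 z hz)
  have e2 : Γ₂ ∩ Metric.closedBall 0 ε = Δ₂ ∩ Metric.closedBall 0 ε := by
    ext z
    exact and_congr_left fun hz => iff_of_eq (h4 z hz)
  rwa [e1, e2] at hε

/-- Exponents are compared by letting `r` tend to `0`. -/
lemma le_of_eventually_rpow_le {a b A B : ℝ} (hA : 0 < A) (hB : 0 < B)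
    (h : ∀ᶠ r in 𝓝[>] (0 : ℝ), A * r ^ a ≤ B * r ^ b) : b ≤ a := by
  by_contra! hab
  have hlim : Tendsto (fun r : ℝ => r ^ (b - a)) (𝓝[>] 0) (𝓝 0) := by
    have h1 := (Real.continuousAt_rpow_const (0 : ℝ) (b - a) (Or.inr (sub_pos.2 hab).le)).tendsto
    rw [Real.zero_rpow (sub_pos.2 hab).ne'] at h1
    exact h1.mono_left nhdsWithin_le_nhds
  obtain ⟨r, h1, h2, h3⟩ := (h.and ((hlim.eventually (gt_mem_nhds (div_pos hA hB))).and
    self_mem_nhdsWithin)).exists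
  have hr : (0 : ℝ) < r := h3
  have h4 : r ^ b = r ^ a * r ^ (b - a) := by rw [← Real.rpow_add hr]; congr 1; ring
  have h5 : 0 < r ^ a := Real.rpow_pos_of_pos hr a
  rw [lt_div_iff₀ hB] at h2
  rw [h4] at h1
  nlinarith

/-- A branch with tangent other than the `y`-axis is Lipschitz over the `x`-axis: moving `x = t ^ N`
a little moves `y` by at most a constant times as much, for a suitable choice of the root. -/
lemma exists_root_near (h : IsPuiseux N χ) :
    ∃ M δ η : ℝ, 0 ≤ M ∧ 0 < δ ∧ 0 < η ∧ ∀ t x : ℂ, ‖t‖ < δ → ‖x - t ^ N‖ ≤ η * ‖t ^ N‖ →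
      ∃ t' : ℂ, t' ^ N = x ∧ ‖χ t' - χ t‖ ≤ M * ‖x - t ^ N‖ := by
  have hN := h.pos
  have hroot : ∀ x : ℂ, (x ^ ((N : ℂ)⁻¹)) ^ N = x := fun x => Complex.cpow_nat_inv_pow x hN.ne'
  -- the principal root near `1`
  obtain ⟨M₁, η, hM₁, hη, hη1, hu⟩ : ∃ M₁ η : ℝ, 0 ≤ M₁ ∧ 0 < η ∧ η ≤ 1 ∧ ∀ w : ℂ, ‖w - 1‖ ≤ η →
      ‖w ^ ((N : ℂ)⁻¹) - 1‖ ≤ M₁ * ‖w - 1‖ := by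
    have h1 : DifferentiableAt ℂ (fun w : ℂ => w ^ ((N : ℂ)⁻¹)) 1 :=
      DifferentiableAt.cpow (by fun_prop) (by fun_prop) Complex.one_mem_slitPlane
    obtain ⟨M₁, hM₁, hb⟩ := h1.hasFDerivAt.isBigO_sub.exists_nonneg
    obtain ⟨δ, hδ, hball⟩ := Metric.eventually_nhds_iff.1 hb.bound
    refine ⟨M₁, min (δ / 2) 1, hM₁, by positivity, min_le_right _ _, fun w hw => ?_⟩
    have h2 := hball (y := w) (by
      rw [dist_eq_norm]
      exact (hw.trans (min_le_left _ _)).trans_lt (half_lt_self hδ))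
    simpa using h2
  -- `χ t = t ^ N * e t` with `e` bounded and Lipschitz
  have hord : (N : ℕ∞) ≤ analyticOrderAt χ 0 := by
    by_contra! hlt
    obtain ⟨k, hk⟩ := ENat.ne_top_iff_exists.1 (ne_top_of_lt hlt)
    rw [← hk] at hlt
    have hkN : k < N := by exact_mod_cast hlt
    obtain ⟨e, he, he0, hχe⟩ := h.analyticAt.analyticOrderAt_eq_natCast.1 hk.symm
    obtain ⟨C, hC0, hC⟩ := h.isBigO.exists_pos
    have h1 : ∀ᶠ t in 𝓝[≠] (0 : ℂ), ‖e t‖ ≤ C * ‖t‖ ^ (N - k) := by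
      filter_upwards [hC.bound.filter_mono nhdsWithin_le_nhds,
        hχe.filter_mono nhdsWithin_le_nhds, self_mem_nhdsWithin] with t h2 h3 h4
      have ht : 0 < ‖t‖ ^ k := by
        have : 0 < ‖t‖ := norm_pos_iff.2 h4
        positivity
      rw [h3, sub_zero, smul_eq_mul, norm_mul, norm_pow, norm_pow,
        ← Nat.sub_add_cancel hkN.le, pow_add] at h2
      refine le_of_mul_le_mul_left ?_ ht
      calc ‖t‖ ^ k * ‖e t‖ ≤ _ := h2
        _ = _ := by ring
    have h2 : Tendsto (fun t : ℂ => C * ‖t‖ ^ (N - k)) (𝓝[≠] 0) (𝓝 0) := by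
      have h3 : Continuous (fun t : ℂ => C * ‖t‖ ^ (N - k)) := by fun_prop
      have h4 := h3.tendsto 0
      rw [norm_zero, zero_pow (by omega), mul_zero] at h4
      exact h4.mono_left nhdsWithin_le_nhds
    have h3 := le_of_tendsto_of_tendsto (he.continuousAt.norm.tendsto.mono_left nhdsWithin_le_nhds)
      h2 h1
    exact he0 (norm_le_zero_iff.1 h3)
  obtain ⟨e, he, hχe⟩ := (natCast_le_analyticOrderAt h.analyticAt).1 hord
  obtain ⟨Λ, U, hU, hΛ⟩ := (he.contDiffAt (n := 1)).exists_lipschitzOnWith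
  have hbd : ∀ᶠ t in 𝓝 (0 : ℂ), ‖e t‖ < ‖e 0‖ + 1 :=
    he.continuousAt.norm.eventually (gt_mem_nhds (lt_add_one _))
  obtain ⟨ρ, hρ, hball⟩ := Metric.eventually_nhds_iff_ball.1 (hχe.and (hbd.and hU))
  refine ⟨‖e 0‖ + 1 + Λ * ρ * M₁, ρ / (1 + M₁), η, by positivity, by positivity, hη, ?_⟩
  intro t x ht hx
  have ht' : ‖t‖ * (1 + M₁) < ρ := by rwa [lt_div_iff₀ (by positivity)] at ht
  have htρ : ‖t‖ < ρ := lt_of_le_of_lt (by nlinarith [norm_nonneg t]) ht'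
  by_cases ht0 : t = 0
  · subst ht0
    rw [zero_pow hN.ne', norm_zero, mul_zero, sub_zero, norm_le_zero_iff] at hx
    refine ⟨0, by rw [hx, zero_pow hN.ne'], ?_⟩
    rw [sub_self, norm_zero]
    positivity
  have htN : 0 < ‖t ^ N‖ := norm_pos_iff.2 (pow_ne_zero _ ht0)
  have htN0 : t ^ N ≠ 0 := pow_ne_zero _ ht0
  obtain ⟨w, hw⟩ : ∃ w, w = x / t ^ N := ⟨_, rfl⟩
  have hxw : x = t ^ N * w := by rw [hw, mul_div_cancel₀ _ htN0]
  have hxw' : ‖x - t ^ N‖ = ‖t ^ N‖ * ‖w - 1‖ := by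
    rw [← norm_mul, hxw]; congr 1; ring
  have hw1 : ‖w - 1‖ ≤ η := by
    rw [hxw', mul_comm η] at hx
    exact le_of_mul_le_mul_left hx htN
  obtain ⟨u, hu'⟩ : ∃ u, u = w ^ ((N : ℂ)⁻¹) := ⟨_, rfl⟩
  have huw : u ^ N = w := by rw [hu', hroot]
  have hu1 : ‖u - 1‖ ≤ M₁ * ‖w - 1‖ := by rw [hu']; exact hu w hw1
  have htuN : (t * u) ^ N = x := by rw [mul_pow, huw, hxw]
  have hu2 : ‖u‖ ≤ 1 + M₁ := by
    have h2 : ‖u‖ ≤ ‖u - 1‖ + 1 := by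
      have := norm_add_le (u - 1) 1
      rwa [sub_add_cancel, norm_one] at this
    nlinarith [norm_nonneg (w - 1)]
  have htu : ‖t * u‖ < ρ := by
    rw [norm_mul]
    exact lt_of_le_of_lt (mul_le_mul_of_nonneg_left hu2 (norm_nonneg _)) ht'
  have hb1 := hball t (by simpa using htρ)
  have hb2 := hball (t * u) (by simpa using htu)
  refine ⟨t * u, htuN, ?_⟩
  have h3 : χ (t * u) - χ t = t ^ N * ((w - 1) * e (t * u) + (e (t * u) - e t)) := by
    rw [hb1.1, hb2.1, sub_zero, sub_zero, smul_eq_mul, smul_eq_mul, htuN, hxw]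
    ring
  have h4 : ‖e (t * u) - e t‖ ≤ Λ * (ρ * (M₁ * ‖w - 1‖)) := by
    refine (hΛ.norm_sub_le hb2.2.2 hb1.2.2).trans ?_
    refine mul_le_mul_of_nonneg_left ?_ Λ.2
    rw [show t * u - t = t * (u - 1) by ring, norm_mul]
    exact mul_le_mul htρ.le hu1 (norm_nonneg _) hρ.le
  have h5 : ‖(w - 1) * e (t * u)‖ ≤ ‖w - 1‖ * (‖e 0‖ + 1) := by
    rw [norm_mul]
    exact mul_le_mul_of_nonneg_left hb2.2.1.le (norm_nonneg _)
  rw [h3, norm_mul, hxw']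
  calc ‖t ^ N‖ * ‖(w - 1) * e (t * u) + (e (t * u) - e t)‖
      ≤ ‖t ^ N‖ * (‖w - 1‖ * (‖e 0‖ + 1) + Λ * (ρ * (M₁ * ‖w - 1‖))) :=
        mul_le_mul_of_nonneg_left ((norm_add_le _ _).trans (add_le_add h5 h4)) (norm_nonneg _)
    _ = _ := by ring

/-- For branches with different germs, the differences `φ t - χ (ζ t)`, `ζ ^ N = 1`, are all at
least of the size of some power `t ^ m`, and one of them has exactly this size. -/
lemma exists_difference_order (h₁ : IsPuiseux N φ) (h₂ : IsPuiseux N χ)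
    (hne : ¬ branch L N φ =ᶠ[𝓝 0] branch L N χ) :
    ∃ (m : ℕ) (c C : ℝ) (ζ₀ : ℂ), 0 < c ∧ 0 < C ∧ ζ₀ ^ N = 1 ∧
      (∀ᶠ t in 𝓝 (0 : ℂ), ∀ ζ : ℂ, ζ ^ N = 1 → c * ‖t‖ ^ m ≤ ‖φ t - χ (ζ * t)‖) ∧
      ∀ᶠ t in 𝓝 (0 : ℂ), ‖φ t - χ (ζ₀ * t)‖ ≤ C * ‖t‖ ^ m := by
  have hN := h₁.pos
  let S := Polynomial.nthRootsFinset N (1 : ℂ)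
  have hS : ∀ ζ : ℂ, ζ ∈ S ↔ ζ ^ N = 1 := fun ζ => Polynomial.mem_nthRootsFinset hN 1
  have hD := (branch_eq_or_ne (L := L) h₁ h₂).resolve_left hne
  let D : ℂ → ℂ → ℂ := fun ζ t => φ t - χ (ζ * t)
  have hDan : ∀ ζ, AnalyticAt ℂ (D ζ) 0 := fun ζ => h₁.analyticAt.fun_sub
    (AnalyticAt.fun_comp (f := fun t : ℂ => ζ * t) (by simpa using h₂.analyticAt) (by fun_prop))
  have hDorder : ∀ ζ ∈ S, ∃ c C : ℝ, 0 < c ∧ 0 < C ∧ ∀ᶠ t in 𝓝 (0 : ℂ),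
      c * ‖t‖ ^ analyticOrderNatAt (D ζ) 0 ≤ ‖D ζ t‖ ∧
        ‖D ζ t‖ ≤ C * ‖t‖ ^ analyticOrderNatAt (D ζ) 0 := by
    intro ζ hζ
    have htop : analyticOrderAt (D ζ) 0 ≠ ⊤ := by
      rw [ne_eq, analyticOrderAt_eq_top]; exact hD ζ ((hS ζ).1 hζ)
    obtain ⟨e, he, he0, hDe⟩ := (hDan ζ).analyticOrderAt_ne_top.1 htop
    have hpos : 0 < ‖e 0‖ := norm_pos_iff.2 he0
    refine ⟨‖e 0‖ / 2, 2 * ‖e 0‖, by positivity, by positivity, ?_⟩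
    filter_upwards [hDe, he.continuousAt.norm.eventually (lt_mem_nhds (half_lt_self hpos)),
      he.continuousAt.norm.eventually (gt_mem_nhds (by linarith : ‖e 0‖ < 2 * ‖e 0‖))]
      with t h1 h2 h3
    rw [h1, sub_zero, smul_eq_mul, norm_mul, norm_pow, mul_comm (‖t‖ ^ _)]
    constructor <;> gcongr
  have hSne : S.Nonempty := ⟨1, (hS 1).2 (one_pow N)⟩
  obtain ⟨ζ₀, hζ₀, hmax⟩ := S.exists_max_image (fun ζ => analyticOrderNatAt (D ζ) 0) hSne
  choose! c C hc hC hcC using hDorder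
  obtain ⟨ζ₁, hζ₁, hmin⟩ := S.exists_min_image c hSne
  refine ⟨analyticOrderNatAt (D ζ₀) 0, c ζ₁, C ζ₀, ζ₀, hc _ hζ₁, hC _ hζ₀, (hS _).1 hζ₀, ?_, ?_⟩
  · have h1 : ∀ᶠ t in 𝓝 (0 : ℂ), ‖t‖ < 1 := by
      filter_upwards [Metric.ball_mem_nhds (0 : ℂ) one_pos] with t ht
      simpa using ht
    filter_upwards [(Filter.eventually_all_finset S).2 hcC, h1] with t h2 h3 ζ hζ
    rw [← hS] at hζ
    refine le_trans ?_ (h2 ζ hζ).1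
    exact mul_le_mul (hmin ζ hζ) (pow_le_pow_of_le_one (norm_nonneg t) h3.le (hmax ζ hζ))
      (by positivity) (hc ζ hζ).le
  · filter_upwards [hcC ζ₀ hζ₀] with t ht
    exact ht.2

lemma norm_le_symm_mul_norm (v : ℂ × ℂ) : ‖v‖ ≤ (‖(L.symm : C2 →L[ℂ] ℂ × ℂ)‖ + 1) * ‖L v‖ := by
  have h1 := (L.symm : C2 →L[ℂ] ℂ × ℂ).le_opNorm (L v)
  simp only [ContinuousLinearEquiv.coe_coe, ContinuousLinearEquiv.symm_apply_apply] at h1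
  nlinarith [norm_nonneg (L v)]

lemma norm_le_mul_norm (v : ℂ × ℂ) : ‖L v‖ ≤ (‖(L : ℂ × ℂ →L[ℂ] C2)‖ + 1) * ‖v‖ := by
  have h1 := (L : ℂ × ℂ →L[ℂ] C2).le_opNorm v
  simp only [ContinuousLinearEquiv.coe_coe] at h1
  nlinarith [norm_nonneg v]

lemma exists_norm_arc_le (h : IsPuiseux N φ) :
    ∃ C : ℝ, 0 < C ∧ ∀ᶠ t in 𝓝 (0 : ℂ), ‖arc L N φ t‖ ≤ C * ‖t‖ ^ N := by
  have h1 : (fun t => (t ^ N, φ t)) =O[𝓝 0] fun t : ℂ => t ^ N :=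
    (Asymptotics.isBigO_refl _ _).prod_left h.isBigO
  have h2 : arc L N φ =O[𝓝 0] fun t : ℂ => t ^ N :=
    ((L : ℂ × ℂ →L[ℂ] C2).isBigO_comp _ _).trans h1
  obtain ⟨C, hC, hb⟩ := h2.exists_pos
  exact ⟨C, hC, by simpa using hb.bound⟩

lemma le_norm_arc (t : ℂ) :
    ‖t‖ ^ N ≤ (‖(L.symm : C2 →L[ℂ] ℂ × ℂ)‖ + 1) * ‖arc L N φ t‖ := by
  refine le_trans ?_ (norm_le_symm_mul_norm (L := L) (t ^ N, φ t))
  rw [Prod.norm_def, norm_pow]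
  exact le_max_left _ _

lemma pow_eq_rpow_div {x : ℝ} (hx : 0 ≤ x) (hN : 0 < N) (m : ℕ) :
    x ^ m = (x ^ N) ^ ((m : ℝ) / N) := by
  have hN' : (N : ℝ) ≠ 0 := by exact_mod_cast hN.ne'
  rw [← Real.rpow_natCast x N, ← Real.rpow_mul hx, mul_div_cancel₀ _ hN', Real.rpow_natCast]

/-- Points of two branches with norm at least `r` have distance at least `A * r ^ (m / N)`. -/
lemma exists_contact_lower_bound (h₁ : IsPuiseux N φ) (h₂ : IsPuiseux N χ) {m : ℕ} {c : ℝ}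
    (hNm : N ≤ m) (hc : 0 < c)
    (hlow : ∀ᶠ t in 𝓝 (0 : ℂ), ∀ ζ : ℂ, ζ ^ N = 1 → c * ‖t‖ ^ m ≤ ‖φ t - χ (ζ * t)‖) :
    ∃ A δ : ℝ, 0 < A ∧ 0 < δ ∧ ∀ s t : ℂ, ‖s‖ < δ → ‖t‖ < δ → ∀ r : ℝ, 0 < r → r ≤ 1 →
      r ≤ ‖arc L N φ s‖ → r ≤ ‖arc L N χ t‖ →
      A * r ^ ((m : ℝ) / N) ≤ ‖arc L N φ s - arc L N χ t‖ := by
  have hN := h₁.pos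
  have hq : (1 : ℝ) ≤ (m : ℝ) / N := by
    rw [le_div_iff₀ (by exact_mod_cast hN), one_mul]; exact_mod_cast hNm
  obtain ⟨a, ha⟩ : ∃ a, a = ‖(L.symm : C2 →L[ℂ] ℂ × ℂ)‖ + 1 := ⟨_, rfl⟩
  have ha0 : 0 < a := by rw [ha]; positivity
  obtain ⟨C₁, hC₁, hφC⟩ := exists_norm_arc_le (L := L) h₁
  obtain ⟨C₂, hC₂, hχC⟩ := exists_norm_arc_le (L := L) h₂
  obtain ⟨M, δ₀, η, hM, hδ₀, hη, hnear⟩ := exists_root_near h₂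
  obtain ⟨δ₁, hδ₁, hball⟩ := Metric.eventually_nhds_iff.1 (hφC.and (hχC.and hlow))
  refine ⟨min (η / (a * C₂)) (c / (a * (1 + M)) * (C₁⁻¹) ^ ((m : ℝ) / N)), min δ₀ δ₁,
    by positivity, by positivity, fun s t hs ht r hr hr1 hrs hrt => ?_⟩
  have hs1 := hball (y := s) (by simpa using hs.trans_le (min_le_right _ _))
  have ht1 := hball (y := t) (by simpa using ht.trans_le (min_le_right _ _))
  have hsN : r ≤ C₁ * ‖s‖ ^ N := hrs.trans hs1.1
  have htN : r ≤ C₂ * ‖t‖ ^ N := hrt.trans ht1.2.1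
  obtain ⟨D, hD⟩ : ∃ D, D = ‖arc L N φ s - arc L N χ t‖ := ⟨_, rfl⟩
  have hsub : arc L N φ s - arc L N χ t = L (s ^ N - t ^ N, φ s - χ t) := by
    rw [arc, arc, ← map_sub, Prod.mk_sub_mk]
  have hmax : ‖((s ^ N - t ^ N, φ s - χ t) : ℂ × ℂ)‖ ≤ a * D := by
    rw [hD, hsub, ha]; exact norm_le_symm_mul_norm _
  have hx : ‖s ^ N - t ^ N‖ ≤ a * D := (norm_fst_le (s ^ N - t ^ N, φ s - χ t)).trans hmax
  have hy : ‖φ s - χ t‖ ≤ a * D := (norm_snd_le (s ^ N - t ^ N, φ s - χ t)).trans hmax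
  have hrq : 0 < r ^ ((m : ℝ) / N) := Real.rpow_pos_of_pos hr _
  rw [← hD]
  by_cases hcase : ‖s ^ N - t ^ N‖ ≤ η * ‖t ^ N‖
  · -- the `x`-coordinates are close, so the points can be compared over the same `x`-coordinate
    obtain ⟨t', ht', hMt⟩ := hnear t (s ^ N) (ht.trans_le (min_le_left _ _)) hcase
    have hs0 : s ≠ 0 := by
      rintro rfl
      rw [norm_zero, zero_pow hN.ne', mul_zero] at hsN
      linarith
    have h3 := hs1.2.2 (t' / s) (by rw [div_pow, ht', div_self (pow_ne_zero _ hs0)])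
    rw [div_mul_cancel₀ _ hs0] at h3
    have h4 : ‖φ s - χ t'‖ ≤ ‖φ s - χ t‖ + ‖χ t' - χ t‖ := by
      have := norm_sub_le (φ s - χ t) (χ t' - χ t)
      rwa [sub_sub_sub_cancel_right] at this
    have h5 : M * ‖s ^ N - t ^ N‖ ≤ M * (a * D) := mul_le_mul_of_nonneg_left hx hM
    have h6 : c * ‖s‖ ^ m ≤ a * (1 + M) * D := by
      calc c * ‖s‖ ^ m ≤ a * D + M * (a * D) := by linarith
        _ = _ := by ring
    have h7 : (C₁⁻¹) ^ ((m : ℝ) / N) * r ^ ((m : ℝ) / N) ≤ ‖s‖ ^ m := by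
      rw [pow_eq_rpow_div (norm_nonneg _) hN, ← Real.mul_rpow (by positivity) hr.le]
      refine Real.rpow_le_rpow (by positivity) ?_ (by positivity)
      rw [inv_mul_le_iff₀ hC₁]
      exact hsN
    calc _ ≤ c / (a * (1 + M)) * (C₁⁻¹) ^ ((m : ℝ) / N) * r ^ ((m : ℝ) / N) :=
          mul_le_mul_of_nonneg_right (min_le_right _ _) hrq.le
      _ = c * ((C₁⁻¹) ^ ((m : ℝ) / N) * r ^ ((m : ℝ) / N)) / (a * (1 + M)) := by ring
      _ ≤ c * ‖s‖ ^ m / (a * (1 + M)) := by gcongr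
      _ ≤ D := by rw [div_le_iff₀ (by positivity), mul_comm D]; exact h6
  · -- the `x`-coordinates alone are at distance at least a multiple of `r`
    push Not at hcase
    have h3 : r ^ ((m : ℝ) / N) ≤ r := by
      have := Real.rpow_le_rpow_of_exponent_ge hr hr1 hq
      rwa [Real.rpow_one] at this
    rw [norm_pow] at hcase
    have h4 : η * r ≤ a * C₂ * D := by
      calc η * r ≤ η * (C₂ * ‖t‖ ^ N) := by gcongr
        _ = C₂ * (η * ‖t‖ ^ N) := by ring
        _ ≤ C₂ * (a * D) := mul_le_mul_of_nonneg_left (hcase.le.trans hx) hC₂.le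
        _ = _ := by ring
    calc _ ≤ η / (a * C₂) * r ^ ((m : ℝ) / N) :=
          mul_le_mul_of_nonneg_right (min_le_left _ _) hrq.le
      _ ≤ η / (a * C₂) * r := by gcongr
      _ = η * r / (a * C₂) := by ring
      _ ≤ D := by rw [div_le_iff₀ (by positivity), mul_comm D]; exact h4

/-- Over the same `x = t ^ N`, for the root of unity that gives the largest order, there are points
of norm about `r` at distance at most `B * r ^ (m / N)`. -/
lemma exists_contact_upper_bound (h₁ : IsPuiseux N φ) (h₂ : IsPuiseux N χ) {m : ℕ} {C : ℝ} {ζ₀ : ℂ}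
    (hC : 0 < C) (hζ₀ : ζ₀ ^ N = 1)
    (hupp : ∀ᶠ t in 𝓝 (0 : ℂ), ‖φ t - χ (ζ₀ * t)‖ ≤ C * ‖t‖ ^ m) :
    ∃ B : ℝ, 0 < B ∧ ∀ ε : ℝ, 0 < ε → ∀ᶠ r in 𝓝[>] (0 : ℝ),
      ∃ γ₁ ∈ branch L N φ ∩ Metric.closedBall 0 ε, ∃ γ₂ ∈ branch L N χ ∩ Metric.closedBall 0 ε,
        r ≤ ‖γ₁‖ ∧ r ≤ ‖γ₂‖ ∧ ‖γ₁ - γ₂‖ ≤ B * r ^ ((m : ℝ) / N) := by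
  have hN := h₁.pos
  obtain ⟨a, ha⟩ : ∃ a, a = ‖(L.symm : C2 →L[ℂ] ℂ × ℂ)‖ + 1 := ⟨_, rfl⟩
  have ha0 : 0 < a := by rw [ha]; positivity
  refine ⟨(‖(L : ℂ × ℂ →L[ℂ] C2)‖ + 1) * (C * a ^ ((m : ℝ) / N)), by positivity, fun ε hε => ?_⟩
  -- the parameter for which `‖t ^ N‖ = a * r`
  let s : ℝ → ℂ := fun r => (((a * r) ^ ((N : ℝ)⁻¹) : ℝ) : ℂ)
  have hs : Tendsto s (𝓝[>] 0) (𝓝 0) := by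
    have h3 : ContinuousAt (fun r : ℝ => (a * r) ^ ((N : ℝ)⁻¹)) 0 :=
      ContinuousAt.rpow_const (by fun_prop) (Or.inr (by positivity))
    have h4 : ContinuousAt s 0 := Complex.continuous_ofReal.continuousAt.comp h3
    have h5 := h4.tendsto
    have h6 : s 0 = 0 := by
      simp only [s, mul_zero]
      rw [Real.zero_rpow (by simpa using hN.ne')]
      simp
    rw [h6] at h5
    exact h5.mono_left nhdsWithin_le_nhds
  have hζs : Tendsto (fun r => ζ₀ * s r) (𝓝[>] 0) (𝓝 0) := by simpa using hs.const_mul ζ₀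
  have hζ₀n : ‖ζ₀‖ = 1 := by
    have := congrArg norm hζ₀
    rw [norm_pow, norm_one] at this
    exact (pow_eq_one_iff_of_nonneg (norm_nonneg _) hN.ne').1 this
  filter_upwards [hs.eventually hupp,
    (((tendsto_arc (L := L) h₁).comp hs).eventually (Metric.closedBall_mem_nhds (0 : C2) hε)),
    (((tendsto_arc (L := L) h₂).comp hζs).eventually (Metric.closedBall_mem_nhds (0 : C2) hε)),
    self_mem_nhdsWithin] with r h3 h4 h5 h6
  have hr : (0 : ℝ) < r := h6
  have hsN : ‖s r‖ ^ N = a * r := by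
    rw [Complex.norm_real, Real.norm_eq_abs, abs_of_nonneg (by positivity),
      Real.rpow_inv_natCast_pow (by positivity) hN.ne']
  refine ⟨_, ⟨⟨s r, rfl⟩, h4⟩, _, ⟨⟨ζ₀ * s r, rfl⟩, h5⟩, ?_, ?_, ?_⟩
  · have := le_norm_arc (L := L) (N := N) (φ := φ) (s r)
    rw [← ha, hsN] at this
    exact le_of_mul_le_mul_left this ha0
  · have := le_norm_arc (L := L) (N := N) (φ := χ) (ζ₀ * s r)
    rw [← ha, norm_mul, hζ₀n, one_mul, hsN] at this
    exact le_of_mul_le_mul_left this ha0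
  · have e : arc L N φ (s r) - arc L N χ (ζ₀ * s r) = L (0, φ (s r) - χ (ζ₀ * s r)) := by
      rw [arc, arc, ← map_sub, mul_pow, hζ₀, one_mul]
      simp
    rw [e]
    refine (norm_le_mul_norm _).trans ?_
    rw [mul_assoc]
    refine mul_le_mul_of_nonneg_left ?_ (by positivity)
    rw [Prod.norm_def, norm_zero, max_eq_right (norm_nonneg _)]
    refine h3.trans ?_
    rw [pow_eq_rpow_div (norm_nonneg _) hN, hsN, Real.mul_rpow ha0.le hr.le, mul_assoc]

lemma bddBelow_contactDist (Γ₁ Γ₂ : Set C2) (r : ℝ) :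
    BddBelow {d : ℝ | ∃ γ₁ ∈ Γ₁, ∃ γ₂ ∈ Γ₂, r ≤ ‖γ₁‖ ∧ r ≤ ‖γ₂‖ ∧ d = ‖γ₁ - γ₂‖} :=
  ⟨0, by rintro _ ⟨γ₁, -, γ₂, -, -, -, rfl⟩; exact norm_nonneg _⟩

/-- Two different branches with the same `x = t ^ N` have a contact, and it is at least `1`. -/
lemma exists_hasPowerContact_branch (h₁ : IsPuiseux N φ) (h₂ : IsPuiseux N χ)
    (hne : ¬ branch L N φ =ᶠ[𝓝 0] branch L N χ) :
    ∃ q : ℝ, 1 ≤ q ∧ HasPowerContact (branch L N φ) (branch L N χ) q := by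
  have hN := h₁.pos
  obtain ⟨m, c, C, ζ₀, hc, hC, hζ₀, hlow, hupp⟩ := exists_difference_order h₁ h₂ hne
  have hNm : N ≤ m := by
    obtain ⟨C₁, hC₁, hφC⟩ := h₁.isBigO.exists_pos
    obtain ⟨C₂, hC₂, hχC⟩ := h₂.isBigO.exists_pos
    have h3 : ∀ᶠ t in 𝓝 (0 : ℂ), c * ‖t‖ ^ m ≤ (C₁ + C₂) * ‖t‖ ^ N := by
      filter_upwards [hlow, hφC.bound, hχC.bound] with t h4 h5 h6
      have h7 := h4 1 (one_pow N)
      rw [one_mul] at h7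
      rw [norm_pow] at h5 h6
      calc c * ‖t‖ ^ m ≤ ‖φ t‖ + ‖χ t‖ := h7.trans (norm_sub_le _ _)
        _ ≤ _ := by rw [add_mul]; exact add_le_add h5 h6
    have h4 : Tendsto (fun r : ℝ => (r : ℂ)) (𝓝[>] 0) (𝓝 0) := by
      have := Complex.continuous_ofReal.tendsto 0
      rw [Complex.ofReal_zero] at this
      exact this.mono_left nhdsWithin_le_nhds
    have h5 : (N : ℝ) ≤ m := by
      refine le_of_eventually_rpow_le hc (by positivity : 0 < C₁ + C₂) ?_
      filter_upwards [h4.eventually h3, self_mem_nhdsWithin] with r h6 h7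
      have hr : (0 : ℝ) < r := h7
      rw [Complex.norm_real, Real.norm_eq_abs, abs_of_pos hr] at h6
      rw [Real.rpow_natCast, Real.rpow_natCast]
      exact h6
    exact_mod_cast h5
  refine ⟨(m : ℝ) / N, ?_, ?_⟩
  · rw [le_div_iff₀ (by exact_mod_cast hN), one_mul]; exact_mod_cast hNm
  obtain ⟨A, δ, hA, hδ, hlower⟩ := exists_contact_lower_bound (L := L) h₁ h₂ hNm hc hlow
  obtain ⟨B, hB, hupper⟩ := exists_contact_upper_bound (L := L) h₁ h₂ hC hζ₀ hupp
  have hsmall : ∀ᶠ t in 𝓝 (0 : ℂ), ‖t‖ < δ := by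
    filter_upwards [Metric.ball_mem_nhds (0 : ℂ) hδ] with t ht
    simpa using ht
  filter_upwards [eventually_forall_mem_closedBall
      (eventually_forall_arc_eq (L := L) (N := N) (φ := φ) hsmall),
    eventually_forall_mem_closedBall
      (eventually_forall_arc_eq (L := L) (N := N) (φ := χ) hsmall), self_mem_nhdsWithin]
    with ε h3 h4 hε
  refine ⟨A, B, hA, hB, ?_⟩
  filter_upwards [hupper ε hε, Ioo_mem_nhdsGT one_pos] with r h5 h6
  obtain ⟨γ₁, hγ₁, γ₂, hγ₂, h7, h8, h9⟩ := h5
  constructor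
  · refine le_csInf ⟨_, γ₁, hγ₁, γ₂, hγ₂, h7, h8, rfl⟩ ?_
    rintro _ ⟨_, ⟨⟨s, rfl⟩, hs⟩, _, ⟨⟨t, rfl⟩, ht⟩, h10, h11, rfl⟩
    exact hlower s t (h3 _ hs s rfl) (h4 _ ht t rfl) r h6.1 h6.2.le h10 h11
  · exact (csInf_le (bddBelow_contactDist _ _ _) ⟨γ₁, hγ₁, γ₂, hγ₂, h7, h8, rfl⟩).trans h9

/-- Different components of a plane curve germ have a contact, and it is at least `1`. -/
lemma exists_hasPowerContact {X Z W : Set C2} (hX : IsPlaneCurveGerm X)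
    (hZ : IsIrreducibleComponentGerm Z X) (hW : IsIrreducibleComponentGerm W X)
    (hne : ¬ Z =ᶠ[𝓝 0] W) : ∃ q : ℝ, 1 ≤ q ∧ HasPowerContact Z W q := by
  obtain ⟨L, N, l, hl, hXl⟩ := exists_branches hX
  obtain ⟨φ, hφ, hZφ⟩ := (isIrreducibleComponentGerm_iff hl hXl).1 hZ
  obtain ⟨χ, hχ, hWχ⟩ := (isIrreducibleComponentGerm_iff hl hXl).1 hW
  obtain ⟨q, hq, h1⟩ := exists_hasPowerContact_branch (L := L) (hl φ hφ) (hl χ hχ)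
    fun h => hne (hZφ.trans (h.trans hWχ.symm))
  exact ⟨q, hq, h1.congr hZφ.symm hWχ.symm⟩

/-! ### Comparison of contacts -/

/-- The contact of the images under a bi-`α`-Hölder homeomorphism is at most `α⁻²` times the
original one: both the condition `r ≤ ‖γ‖` and the distance change by an exponent `α`. -/
lemma contact_mul_sq_le {α : NNReal} (hα : 0 < α) {X Y : Set C2} {h : PartialEquiv C2 C2}
    (hh : IsBiHolderGermHomeo α X Y h) {Γ₁ Γ₂ : Set C2} {q q' : ℝ}
    (h₁ : HasPowerContact Γ₁ Γ₂ q) (h₂ : HasPowerContact (germImage h Γ₁) (germImage h Γ₂) q') :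
    q' * (α : ℝ) ^ 2 ≤ q := by
  have hα' : (0 : ℝ) < α := hα
  obtain ⟨K₁, hK₁⟩ := hh.holder
  obtain ⟨K₂, hK₂⟩ := hh.holder_symm
  obtain ⟨K, hK0, hK1, hK2⟩ : ∃ K : ℝ, 0 < K ∧ (K₁ : ℝ) ≤ K ∧ (K₂ : ℝ) ≤ K :=
    ⟨K₁ + K₂ + 1, by positivity, by linarith [K₂.2], by linarith [K₁.2]⟩
  have hdist : ∀ z ∈ h.source, ∀ w ∈ h.source, ‖h z - h w‖ ≤ K * ‖z - w‖ ^ (α : ℝ) := by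
    intro z hz w hw
    rw [← dist_eq_norm, ← dist_eq_norm]
    exact (hK₁.dist_le hz hw).trans (by gcongr)
  have hdist' : ∀ z ∈ h.source, ∀ w ∈ h.source, ‖z - w‖ ≤ K * ‖h z - h w‖ ^ (α : ℝ) := by
    intro z hz w hw
    have h1 := hK₂.dist_le (h.map_source hz) (h.map_source hw)
    rw [h.left_inv hz, h.left_inv hw] at h1
    rw [← dist_eq_norm, ← dist_eq_norm]
    exact h1.trans (by gcongr)
  have hnorm : ∀ z ∈ h.source, ‖h z‖ ≤ K * ‖z‖ ^ (α : ℝ) := by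
    intro z hz
    have := hdist z hz 0 hh.zero_mem
    rwa [hh.map_zero, sub_zero, sub_zero] at this
  -- compatible radii of the representatives on both sides
  obtain ⟨ε, ⟨A, B, hA, hB, hAB⟩, hε⟩ := (h₁.and self_mem_nhdsWithin).exists
  have hball : ∀ᶠ ε' in 𝓝[>] (0 : ℝ), ∀ w ∈ Metric.closedBall (0 : C2) ε', ∀ z ∈ h.source,
      h z = w → z ∈ Metric.closedBall (0 : C2) ε :=
    eventually_forall_mem_closedBall
      (eventually_germImage hα hh (Metric.closedBall_mem_nhds (0 : C2) hε))
  obtain ⟨ε', hball', A', B', hA', hB', hAB'⟩ := (hball.and h₂).exists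
  -- the radius on the source side that corresponds to `r`
  have hlim : Tendsto (fun r : ℝ => (r / K) ^ ((α : ℝ)⁻¹)) (𝓝[>] 0) (𝓝[>] 0) := by
    refine tendsto_nhdsWithin_iff.2 ⟨?_, ?_⟩
    · have h3 : ContinuousAt (fun r : ℝ => (r / K) ^ ((α : ℝ)⁻¹)) 0 :=
        ContinuousAt.rpow_const (by fun_prop) (Or.inr (by positivity))
      have h4 := h3.tendsto
      rw [zero_div, Real.zero_rpow (by positivity)] at h4
      exact h4.mono_left nhdsWithin_le_nhds
    · filter_upwards [self_mem_nhdsWithin] with r hr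
      have hr' : (0 : ℝ) < r := hr
      exact Real.rpow_pos_of_pos (by positivity) _
  have key : q' * α ≤ (α : ℝ)⁻¹ * q := by
    refine le_of_eventually_rpow_le (A := A * (K⁻¹) ^ ((α : ℝ)⁻¹ * q))
      (B := K * (2 * B') ^ (α : ℝ)) (by positivity) (by positivity) ?_
    filter_upwards [hlim.eventually hAB, hAB', self_mem_nhdsWithin] with r h3 h4 h5
    have hr : (0 : ℝ) < r := h5
    have hpos : 0 < A' * r ^ q' := mul_pos hA' (Real.rpow_pos_of_pos hr _)
    have hBpos : 0 < B' * r ^ q' := mul_pos hB' (Real.rpow_pos_of_pos hr _)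
    have hlt : contactDist (germImage h Γ₁ ∩ Metric.closedBall 0 ε')
        (germImage h Γ₂ ∩ Metric.closedBall 0 ε') r < 2 * B' * r ^ q' := by
      linarith [h4.2]
    -- the infimum is taken over a nonempty set, since it is positive
    have hne : {d : ℝ | ∃ γ₁ ∈ germImage h Γ₁ ∩ Metric.closedBall 0 ε',
        ∃ γ₂ ∈ germImage h Γ₂ ∩ Metric.closedBall 0 ε',
          r ≤ ‖γ₁‖ ∧ r ≤ ‖γ₂‖ ∧ d = ‖γ₁ - γ₂‖}.Nonempty := by
      by_contra hempty
      rw [Set.not_nonempty_iff_eq_empty] at hempty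
      have := h4.1
      rw [contactDist, hempty, Real.sInf_empty] at this
      linarith
    obtain ⟨_, ⟨_, ⟨⟨z, ⟨hz, hzΓ⟩, rfl⟩, hzε⟩, _, ⟨⟨w, ⟨hw, hwΓ⟩, rfl⟩, hwε⟩, hrz, hrw, rfl⟩, hd⟩ :=
      exists_lt_of_csInf_lt hne hlt
    have hrad : ∀ y ∈ h.source, r ≤ ‖h y‖ → (r / K) ^ ((α : ℝ)⁻¹) ≤ ‖y‖ := by
      intro y hy hry
      rw [Real.rpow_inv_le_iff_of_pos (by positivity) (norm_nonneg _) hα', div_le_iff₀ hK0,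
        mul_comm]
      exact hry.trans (hnorm y hy)
    have h6 : contactDist (Γ₁ ∩ Metric.closedBall 0 ε) (Γ₂ ∩ Metric.closedBall 0 ε)
        ((r / K) ^ ((α : ℝ)⁻¹)) ≤ ‖z - w‖ :=
      csInf_le (bddBelow_contactDist _ _ _) ⟨z, ⟨hzΓ, hball' _ hzε z hz rfl⟩, w,
        ⟨hwΓ, hball' _ hwε w hw rfl⟩, hrad z hz hrz, hrad w hw hrw, rfl⟩
    calc A * (K⁻¹) ^ ((α : ℝ)⁻¹ * q) * r ^ ((α : ℝ)⁻¹ * q)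
        = A * ((r / K) ^ ((α : ℝ)⁻¹)) ^ q := by
          rw [← Real.rpow_mul (by positivity), mul_assoc,
            ← Real.mul_rpow (by positivity) hr.le, inv_mul_eq_div]
      _ ≤ ‖z - w‖ := h3.1.trans h6
      _ ≤ K * ‖h z - h w‖ ^ (α : ℝ) := hdist' z hz w hw
      _ ≤ K * (2 * B' * r ^ q') ^ (α : ℝ) := by gcongr
      _ = K * (2 * B') ^ (α : ℝ) * r ^ (q' * α) := by
          rw [Real.mul_rpow (by positivity) (by positivity), ← Real.rpow_mul hr.le]
          ring
  rw [inv_mul_eq_div, le_div_iff₀ hα'] at key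
  linarith

end PlaneCurve

open PlaneCurve

theorem mainTheorem9 (α : NNReal) (hα : 0 < α) (X Y : Set C2)
    (hX : IsPlaneCurveGerm X) (hY : IsPlaneCurveGerm Y)
    (h : PartialEquiv C2 C2) (hh : IsBiHolderGermHomeo α X Y h)
    (r : ℕ) (C : Fin r → Set C2) (hC : AreIrreducibleComponents C X) :
    AreIrreducibleComponents (fun i => germImage h (C i)) Y ∧
      ∀ i j : Fin r, i ≠ j →
        ∃ c c' : ℝ, HasContact (C i) (C j) c ∧
          HasContact (germImage h (C i)) (germImage h (C j)) c' ∧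
          (α : ℝ) ^ 2 ≤ c / c' ∧ c / c' ≤ 1 / (α : ℝ) ^ 2 := by
  have hC' := areIrreducibleComponents_germImage hα hX hY hh hC
  refine ⟨hC', fun i j hij => ?_⟩
  obtain ⟨q, hq, h1⟩ := exists_hasPowerContact hX (hC.1 i) (hC.1 j) fun he => hij (hC.2.2 i j he)
  obtain ⟨q', hq', h2⟩ := exists_hasPowerContact hY (hC'.1 i) (hC'.1 j)
    fun he => hij (hC'.2.2 i j he)
  have hα' : (0 : ℝ) < α := hα
  have hq'0 : 0 < q' := by linarith
  refine ⟨q, q', h1.hasContact, h2.hasContact, ?_, ?_⟩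
  · rw [le_div_iff₀ hq'0, mul_comm]
    exact contact_mul_sq_le hα hh h1 h2
  · have hsymm := biHolder_symm hh
    have e1 := germImage_symm_germImage_eq hh (hC.1 i).2.1
    have e2 := germImage_symm_germImage_eq hh (hC.1 j).2.1
    have h3 := contact_mul_sq_le hα hsymm h2 (h1.congr e1.symm e2.symm)
    rw [div_le_div_iff₀ hq'0 (by positivity)]
    linarith
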